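/- Let $\mathcal S$ and $\mathcal A$ be finite non-empty sets, let $\tau:\mathcal S\times\mathcal A\to\Delta(\mathcal S)$ be a transition function and $\mu_0\in\Delta(\mathcal S)$ an initial distribution such that all states are reachable under $\tau$ and $\mu_0$, and let $\gamma\in(0,1)$, $\beta>0$, $\alpha>0$, $\epsilon\ge 0$. Let $\mathcal R$ be the set of all reward functions $R:\mathcal S\times\mathcal A\times\mathcal S\to\mathbb R$, with the $\ell^2$-norm, and $\Pi$ the set of all policies $\pi:\mathcal S\to\Delta(\mathcal A)$. For $R\in\mathcal R$ let $b_{\tau,\gamma,\beta}(R)$ be the policy with $\pi(a\mid s)\propto e^{\beta Q^\star(s,a)}$, where $Q^\star$ is the optimal $Q$-function of $R$, and let $c_{\tau,\gamma,\alpha}(R)$ be the policy that maximises $\mathbb E\big[\sum_{t\ge0}\gamma^t\big(R(S_t,A_t,S_{t+1})+\alpha H(\pi(S_t))\big)\big]$, where $S_0\sim\mu_0$ and $H$ is the Shannon entropy. Rewards $R_1,R_2$ differ by potential shaping if $R_2(s,a,s')=R_1(s,a,s')+\gamma\Phi(s')-\Phi(s)$ for some $\Phi:\mathcal S\to\mathbb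 R$, by $S'$-redistribution if $\mathbb E_{S'\sim\tau(s,a)}[R_1(s,a,S')]=\mathbb E_{S'\sim\tau(s,a)}[R_2(s,a,S')]$ for all $s,a$, and by positive linear scaling if $R_2=\lambda R_1$ for some $\lambda>0$. Let $c^{\mathrm{STARC}}(R)$ be the element of smallest norm among all rewards that differ from $R$ by potential shaping and $S'$-redistribution, let $s^{\mathrm{STARC}}(R)=c^{\mathrm{STARC}}(R)/\|c^{\mathrm{STARC}}(R)\|_2$ if $c^{\mathrm{STARC}}(R)\ne0$ and $s^{\mathrm{STARC}}(R)=0$ otherwise, and let $d(R_1,R_2)=\tfrac12\|s^{\mathrm{STARC}}(R_1)-s^{\mathrm{STARC}}(R_2)\|_2$. Let $\hat{\mathcal R}\subseteq\mathcal R$. For $f,g:\hat{\mathcal R}\to\Pi$, say that $f$ is $\epsilon$-robust to misspecification with $g$ if (1) $f(R_1)=g(R_2)$ implies $d(R_1,R_2)\le\epsilon$, and (2) $f(R_1)=f(R_2)$ implies $d(R_1,R_2)\le\epsilon$, for all $R_1,R_2\in\hat{\mathcal R}$, (3) $\mathrm{Im}(g)\subseteq\mathrm{Im}(f)$, and (4)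 $f\ne g$. Let $T_\epsilon$ be the set of all $t:\mathcal R\to\mathcal R$ such that $d(R,t(R))\le\epsilon$ for all $R\in\mathcal R$, and let $\hat T_\epsilon$ be the set of all $t\in T_\epsilon$ such that $t(R)\in\hat{\mathcal R}$ for all $R\in\hat{\mathcal R}$. Then, for every $g:\hat{\mathcal R}\to\Pi$: 1. $b_{\tau,\gamma,\beta}:\hat{\mathcal R}\to\Pi$ is $\epsilon$-robust to misspecification with $g$ if and only if $g=b_{\tau,\gamma,\beta}\circ t$ on $\hat{\mathcal R}$ for some $t\in\hat T_\epsilon$, and $b_{\tau,\gamma,\beta}\ne g$ on $\hat{\mathcal R}$. 2. $c_{\tau,\gamma,\alpha}:\hat{\mathcal R}\to\Pi$ is $\epsilon$-robust to misspecification with $g$ if and only if $g=c_{\tau,\gamma,\alpha}\circ t$ on $\hat{\mathcal R}$ for some $t\in\hat T_\epsilon$, and $c_{\tau,\gamma,\alpha}\ne g$ on $\hat{\mathcal R}$. Moreover, if $\epsilon<\tfrac12$, then $T_\epsilon$ is exactly the set of all $t$ that can be written as $t=t_1\circ\dots\circ t_m$ such that, for some $n\in\{1,\dots,m\}$, $\|R-t_n(R)\|_2\le\|c^{\mathrm{STARC}}(R)\|_2\cdot\sin(2\arcsin\epsilon)$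 for all $R$, and for all $i\ne n$ and all $R$, the rewards $R$ and $t_i(R)$ differ by potential shaping, by $S'$-redistribution, or by positive linear scaling. -/

import Mathlib

open MeasureTheory ProbabilityTheory

noncomputable section

/-! ### Reward functions, policies, transition functions -/

/-- Reward functions `R : S × A × S → ℝ`; the norm of this type is the `ℓ²`-norm. -/
abbrev Reward (S A : Type*) := EuclideanSpace ℝ (S × A × S)

/-- Transition functions `τ : S × A → Δ(S)`. -/
abbrev Transition (S A : Type*) := S → A → PMF S

/-- (Stationary, stochastic) policies `π : S → Δ(A)`. -/
abbrev Policy (S A : Type*) := S → PMF A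

instance Policy.instNonempty {S A : Type*} [Nonempty A] : Nonempty (Policy S A) :=
  ⟨fun _ => PMF.pure (Classical.arbitrary A)⟩

/-- Every state is reachable under `τ` from the support of the initial distribution `μ₀`. -/
def AllReachable {S A : Type*} (τ : Transition S A) (μ₀ : PMF S) : Prop :=
  ∀ s : S, ∃ s₀ : S, μ₀ s₀ ≠ 0 ∧ Relation.ReflTransGen (fun x y => ∃ a : A, τ x a y ≠ 0) s₀ s

/-! ### Trajectories and values -/

section Trajectories

variable {S A : Type*} [Fintype S] [Fintype A]

/-- One step of the chain of state-action pairs: from `(s, a)` draw `s' ∼ τ(s, a)`, and then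
`a' ∼ π(s')`. -/
def stepKernel [MeasurableSpace S] [DiscreteMeasurableSpace S]
    [MeasurableSpace A] [DiscreteMeasurableSpace A]
    (τ : Transition S A) (π : Policy S A) : Kernel (S × A) (S × A) where
  toFun x := ((τ x.1 x.2).bind fun s' => (π s').map fun a' => (s', a')).toMeasure
  measurable' := Measurable.of_discrete

instance stepKernel.instIsMarkovKernel [MeasurableSpace S] [DiscreteMeasurableSpace S]
    [MeasurableSpace A] [DiscreteMeasurableSpace A]
    (τ : Transition S A) (π : Policy S A) : IsMarkovKernel (stepKernel τ π) :=
  ⟨fun _ => PMF.toMeasure.isProbabilityMeasure _⟩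

/-- The law of the trajectory `s₀, a₀, s₁, a₁, …` when `s₀ ∼ μ`, and actions are drawn from `π`
and states from `τ`. -/
def trajectoryLaw [MeasurableSpace S] [DiscreteMeasurableSpace S]
    [MeasurableSpace A] [DiscreteMeasurableSpace A]
    (τ : Transition S A) (μ : PMF S) (π : Policy S A) : Measure (ℕ → S × A) :=
  Kernel.trajMeasure (X := fun _ => S × A)
    (μ.bind fun s => (π s).map fun a => (s, a)).toMeasure
    (fun n => (stepKernel τ π).comap
      (fun h : (i : Finset.Iic n) → S × A => h ⟨n, Finset.mem_Iic.2 le_rfl⟩)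
      (measurable_pi_apply _))

/-- The expectation of `F(ξ)` over trajectories `ξ` generated by `π`, started in `μ`. The finite
sets `S` and `A` carry the discrete σ-algebra. -/
def trajectoryExpectation (τ : Transition S A) (μ : PMF S) (π : Policy S A)
    (F : (ℕ → S × A) → ℝ) : ℝ :=
  letI : MeasurableSpace S := ⊤
  letI : MeasurableSpace A := ⊤
  haveI : DiscreteMeasurableSpace S := ⟨fun _ => trivial⟩
  haveI : DiscreteMeasurableSpace A := ⟨fun _ => trivial⟩
  ∫ ξ, F ξ ∂(trajectoryLaw τ μ π)

/-- The discounted return `G(ξ) = ∑ₜ γᵗ R(sₜ, aₜ, sₜ₊₁)`. -/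
def discountedReturn (γ : ℝ) (R : Reward S A) (ξ : ℕ → S × A) : ℝ :=
  ∑' t : ℕ, γ ^ t * R ((ξ t).1, (ξ t).2, (ξ (t + 1)).1)

/-- The value function `V^π(s)`. -/
def valueFn (τ : Transition S A) (γ : ℝ) (R : Reward S A) (π : Policy S A) (s : S) : ℝ :=
  trajectoryExpectation τ (PMF.pure s) π (discountedReturn γ R)

/-- The `Q`-function `Q^π(s, a) = 𝔼[R(s, a, S') + γ V^π(S')]`. -/
def qFn (τ : Transition S A) (γ : ℝ) (R : Reward S A) (π : Policy S A) (s : S) (a : A) : ℝ :=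
  ∑ s' : S, (τ s a s').toReal * (R (s, a, s') + γ * valueFn τ γ R π s')

/-- The optimal `Q`-function `Q⋆(s, a) = sup_π Q^π(s, a)`. -/
def optimalQ (τ : Transition S A) (γ : ℝ) (R : Reward S A) (s : S) (a : A) : ℝ :=
  ⨆ π : Policy S A, qFn τ γ R π s a

/-! ### Behavioural models -/

/-- The Boltzmann-rational policy of `R`: `π(a | s) ∝ exp(β Q⋆(s, a))`. -/
def boltzmannRational [Nonempty A] (τ : Transition S A) (γ β : ℝ) (R : Reward S A) :
    Policy S A := fun s =>
  PMF.normalize (fun a : A => ENNReal.ofReal (Real.exp (β * optimalQ τ γ R s a)))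
    (by
      rw [tsum_fintype]
      intro h
      have h0 := (Finset.sum_eq_zero_iff.1 h) (Classical.arbitrary A) (Finset.mem_univ _)
      exact absurd (ENNReal.ofReal_eq_zero.1 h0) (not_le.2 (Real.exp_pos _)))
    (by
      rw [tsum_fintype]
      exact ENNReal.sum_ne_top.2 fun _ _ => ENNReal.ofReal_ne_top)

/-- Shannon entropy of a distribution on a finite set. -/
def shannonEntropy (p : PMF A) : ℝ := ∑ a : A, Real.negMulLog (p a).toReal

/-- The causal entropy objective `𝔼[∑ₜ γᵗ (R(Sₜ, Aₜ, Sₜ₊₁) + α H(π(Sₜ)))]`. -/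
def causalEntropyObjective (τ : Transition S A) (μ₀ : PMF S) (γ α : ℝ) (R : Reward S A)
    (π : Policy S A) : ℝ :=
  trajectoryExpectation τ μ₀ π fun ξ =>
    ∑' t : ℕ, γ ^ t *
      (R ((ξ t).1, (ξ t).2, (ξ (t + 1)).1) + α * shannonEntropy (π (ξ t).1))

/-- `π` maximises the causal entropy objective. -/
def IsMCEPolicy (τ : Transition S A) (μ₀ : PMF S) (γ α : ℝ) (R : Reward S A)
    (π : Policy S A) : Prop :=
  ∀ π' : Policy S A,
    causalEntropyObjective τ μ₀ γ α R π' ≤ causalEntropyObjective τ μ₀ γ α R π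

/-- The maximal causal entropy policy of `R`, i.e. the maximiser of the causal entropy objective
(which exists and is unique when `0 < α`, `0 < γ < 1` and all states are reachable). -/
def maxCausalEntropy [Nonempty A] (τ : Transition S A) (μ₀ : PMF S) (γ α : ℝ)
    (R : Reward S A) : Policy S A :=
  Classical.epsilon (IsMCEPolicy τ μ₀ γ α R)

/-! ### Transformations of rewards and the STARC metric -/

/-- `R₁` and `R₂` differ by potential shaping with `γ`. -/
def DifferByShaping (γ : ℝ) (R₁ R₂ : Reward S A) : Prop :=
  ∃ Φ : S → ℝ, ∀ s a s', R₂ (s, a, s') = R₁ (s, a, s') + γ * Φ s' - Φ s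

/-- `R₁` and `R₂` differ by `S'`-redistribution with `τ`. -/
def DifferByRedistribution (τ : Transition S A) (R₁ R₂ : Reward S A) : Prop :=
  ∀ s a, ∑ s' : S, (τ s a s').toReal * R₁ (s, a, s') =
    ∑ s' : S, (τ s a s').toReal * R₂ (s, a, s')

/-- `R₁` and `R₂` differ by positive linear scaling. -/
def DifferByScaling (R₁ R₂ : Reward S A) : Prop :=
  ∃ c : ℝ, 0 < c ∧ R₂ = c • R₁

/-- The set `V(R)` of all rewards that differ from `R` by potential shaping and
`S'`-redistribution. -/
def shapingClass (τ : Transition S A) (γ : ℝ) (R : Reward S A) : Set (Reward S A) :=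
  {R' | ∃ R'', DifferByShaping γ R R'' ∧ DifferByRedistribution τ R'' R'}

/-- The canonicalisation `c(R)`: the element of `V(R)` of smallest `ℓ²`-norm (it exists and is
unique, because `V(R)` is an affine subspace). -/
def starcCanon (τ : Transition S A) (γ : ℝ) (R : Reward S A) : Reward S A :=
  Classical.epsilon fun R' => R' ∈ shapingClass τ γ R ∧ ∀ R'' ∈ shapingClass τ γ R, ‖R'‖ ≤ ‖R''‖

/-- The standardisation `s(R)`: `c(R)` divided by its norm if that is positive, and `c(R)`
otherwise. -/
def starcStandard (τ : Transition S A) (γ : ℝ) (R : Reward S A) : Reward S A :=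
  open Classical in
  if 0 < ‖starcCanon τ γ R‖ then (‖starcCanon τ γ R‖)⁻¹ • starcCanon τ γ R
  else starcCanon τ γ R

/-- The STARC distance `d(R₁, R₂) = 0.5 · ‖s(R₁) - s(R₂)‖₂`. -/
def starcDist (τ : Transition S A) (γ : ℝ) (R₁ R₂ : Reward S A) : ℝ :=
  (1 / 2) * ‖starcStandard τ γ R₁ - starcStandard τ γ R₂‖

/-- The transformations `t` with `d(R, t(R)) ≤ ε` for all rewards `R`. -/
def closeTransformations (τ : Transition S A) (γ ε : ℝ) : Set (Reward S A → Reward S A) :=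
  {t | ∀ R, starcDist τ γ R (t R) ≤ ε}

/-- `t` moves each reward by potential shaping, by `S'`-redistribution, or by positive linear
scaling. -/
def IsElementary (τ : Transition S A) (γ : ℝ) (t : Reward S A → Reward S A) : Prop :=
  ∀ R, DifferByShaping γ R (t R) ∨ DifferByRedistribution τ R (t R) ∨ DifferByScaling R (t R)

/-- The composition `t₁ ∘ ⋯ ∘ tₖ` of a list `[t₁, …, tₖ]` of transformations. -/
def composeList (l : List (Reward S A → Reward S A)) : Reward S A → Reward S A :=
  l.foldr (fun t u => t ∘ u) id

/-- The transformations `t₁ ∘ ⋯ ∘ tₙ₋₁ ∘ tₙ ∘ tₙ₊₁ ∘ ⋯ ∘ tₘ` where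
`‖R - tₙ(R)‖₂ ≤ ‖c(R)‖₂ · sin(2 arcsin ε)` for all `R`, and all the other `tᵢ` are elementary. -/
def decomposableTransformations (τ : Transition S A) (γ ε : ℝ) :
    Set (Reward S A → Reward S A) :=
  {t | ∃ (l₁ l₂ : List (Reward S A → Reward S A)) (u : Reward S A → Reward S A),
    t = composeList l₁ ∘ u ∘ composeList l₂ ∧
    (∀ R, ‖R - u R‖ ≤ ‖starcCanon τ γ R‖ * Real.sin (2 * Real.arcsin ε)) ∧
    (∀ f ∈ l₁, IsElementary τ γ f) ∧ (∀ f ∈ l₂, IsElementary τ γ f)}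

/-- The transformations that map the set `Rhat` of rewards into itself. -/
def preserving (Rhat : Set (Reward S A)) : Set (Reward S A → Reward S A) :=
  {t | ∀ R ∈ Rhat, t R ∈ Rhat}

/-! ### Robustness to misspecification -/

/-- `f` is `ε`-robust to misspecification with `g` on `Rhat`, as defined by `d`. -/
structure IsRobust (Rhat : Set (Reward S A)) (d : Reward S A → Reward S A → ℝ) (ε : ℝ)
    (f g : Rhat → Policy S A) : Prop where
  dist_le_of_eq : ∀ R₁ R₂ : Rhat, f R₁ = g R₂ → d R₁ R₂ ≤ ε
  dist_le_of_eq_self : ∀ R₁ R₂ : Rhat, f R₁ = f R₂ → d R₁ R₂ ≤ ε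
  range_subset : Set.range g ⊆ Set.range f
  ne : f ≠ g

end Trajectories

end

/-! Both behavioural models are softmaxes of action values that solve a Bellman equation, with the
maximum (Boltzmann) or `smoothMax` (causal entropy) as aggregator. A softmax determines its logits
up to a function of the state, and by the Bellman equation such a difference in action values is a
potential shaping of the mean rewards (`meanReward_eq_of_bellmanQ_eq_add`). Equal policies thus
force equal shaping classes, which the STARC distance cannot separate. The two equivalences are then
formal (`isRobust_iff_of_congr`): `t` picks preimages of the values of `g`.

For the last claim, `starcCanon` is the orthogonal projection along the shaping directions, so for
`ε < 1/2` the condition `d ≤ ε` says that both canonical rewards vanish, or that they are nonzero at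
angle at most `2 arcsin ε`. The ball of radius `‖x‖ sin θ` around `x` lies in the cone of half-angle
`θ`, and every nonzero point of the cone lies in such a ball around a positive multiple of `x`.
Hence each single `t R` is reached from `R` by elementary moves and one perturbation. To make these
moves values of globally defined maps, `closeTransformations_subset` stores a real code of `R` along
a shaping direction, so that no intermediate map merges two rewards. -/

noncomputable section

/-! ### Expectations under finite distributions -/

section FiniteSums

variable {X Y : Type*} [Fintype X] [Fintype Y]

lemma PMF.sum_toReal_eq_one (p : PMF X) : ∑ x, (p x).toReal = 1 := by
  rw [← ENNReal.toReal_sum fun x _ => p.apply_ne_top x, ← tsum_fintype (L := .unconditional X),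
    p.tsum_coe, ENNReal.toReal_one]

lemma PMF.sum_toReal_mul_const (p : PMF X) (c : ℝ) : ∑ x, (p x).toReal * c = c := by
  rw [← Finset.sum_mul, p.sum_toReal_eq_one, one_mul]

lemma PMF.sum_toReal_bind_mul (p : PMF X) (q : X → PMF Y) (f : Y → ℝ) :
    ∑ y, ((p.bind q) y).toReal * f y = ∑ x, (p x).toReal * ∑ y, (q x y).toReal * f y := by
  have h : ∀ y, ((p.bind q) y).toReal = ∑ x, (p x).toReal * (q x y).toReal := fun y => by
    rw [PMF.bind_apply, tsum_fintype, ENNReal.toReal_sum]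
    · simp only [ENNReal.toReal_mul]
    · exact fun x _ => ENNReal.mul_ne_top (p.apply_ne_top x) ((q x).apply_ne_top y)
  simp only [h, Finset.sum_mul, Finset.mul_sum]
  rw [Finset.sum_comm]
  simp only [mul_assoc]

lemma PMF.sum_toReal_pure_mul (x : X) (f : X → ℝ) :
    ∑ y, ((PMF.pure x) y).toReal * f y = f x := by
  classical
  rw [Finset.sum_eq_single x]
  · simp
  · intro y _ hy
    simp [PMF.pure_apply, hy]
  · simp

lemma PMF.sum_toReal_map_mul (p : PMF X) (g : X → Y) (f : Y → ℝ) :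
    ∑ y, ((p.map g) y).toReal * f y = ∑ x, (p x).toReal * f (g x) := by
  rw [PMF.map, PMF.sum_toReal_bind_mul]
  simp only [Function.comp_apply, PMF.sum_toReal_pure_mul]

end FiniteSums

/-! ### Expected discounted returns along trajectories -/

section Trajectories

variable {S A : Type*} [Fintype S] [Fintype A]

/-- The action values obtained from mean rewards `r` and continuation values `V`. -/
def bellmanQ (τ : Transition S A) (γ : ℝ) (r : S → A → ℝ) (V : S → ℝ) (s : S) (a : A) : ℝ :=
  r s a + γ * ∑ s', (τ s a s').toReal * V s'

/-- The mean of `R(s, a, S')` for `S' ∼ τ(s, a)`. -/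
def meanReward (τ : Transition S A) (R : Reward S A) (s : S) (a : A) : ℝ :=
  ∑ s', (τ s a s').toReal * R (s, a, s')

section Chain

variable [MeasurableSpace S] [DiscreteMeasurableSpace S] [MeasurableSpace A]
  [DiscreteMeasurableSpace A]

instance (τ : Transition S A) (μ : PMF S) (π : Policy S A) :
    IsProbabilityMeasure (trajectoryLaw τ μ π) := by
  unfold trajectoryLaw
  infer_instance

lemma integral_stepKernel (τ : Transition S A) (π : Policy S A) (x : S × A) (f : S × A → ℝ) :
    ∫ y, f y ∂(stepKernel τ π x) =
      ∑ s', (τ x.1 x.2 s').toReal * ∑ a', (π s' a').toReal * f (s', a') := by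
  change ∫ y, f y ∂((τ x.1 x.2).bind fun s' => (π s').map fun a' => (s', a')).toMeasure = _
  rw [PMF.integral_eq_sum]
  simp only [smul_eq_mul, PMF.sum_toReal_bind_mul, PMF.sum_toReal_map_mul]

lemma integral_trajectoryLaw_zero (τ : Transition S A) (μ : PMF S) (π : Policy S A)
    (f : S × A → ℝ) :
    ∫ ξ, f (ξ 0) ∂(trajectoryLaw τ μ π) =
      ∑ s, (μ s).toReal * ∑ a, (π s a).toReal * f (s, a) := by
  have hmap : (trajectoryLaw τ μ π).map (fun ξ => ξ 0) =
      (μ.bind fun s => (π s).map fun a => (s, a)).toMeasure := by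
    unfold trajectoryLaw Kernel.trajMeasure
    rw [Measure.map_comp _ _ (measurable_pi_apply 0)]
    have hcomp : (fun ξ : ℕ → S × A => ξ 0) =
        (fun h : (i : Finset.Iic 0) → S × A => h ⟨0, Finset.mem_Iic.2 le_rfl⟩) ∘
          Preorder.frestrictLe (π := fun _ => S × A) 0 := rfl
    rw [hcomp, Kernel.map_comp_right _ (Preorder.measurable_frestrictLe 0)
      (measurable_pi_apply _), Kernel.traj_map_frestrictLe, Kernel.partialTraj_self,
      ← Measure.map_comp _ _ (measurable_pi_apply _), Measure.id_comp,
      Measure.map_map (measurable_pi_apply _) (MeasurableEquiv.measurable _)]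
    exact Measure.map_id
  rw [← integral_map (φ := fun ξ : ℕ → S × A => ξ 0) (f := f)
    (measurable_pi_apply 0).aemeasurable (Measurable.of_discrete.aestronglyMeasurable), hmap,
    PMF.integral_eq_sum]
  simp only [smul_eq_mul, PMF.sum_toReal_bind_mul, PMF.sum_toReal_map_mul]

/-- The Markov property: the joint law of the history up to `t` and the next pair is a
composition-product whose kernel reads only the last entry of the history. -/
lemma integral_trajectoryLaw_succ (τ : Transition S A) (μ : PMF S) (π : Policy S A) (t : ℕ)
    (f : S × A → S × A → ℝ) :
    ∫ ξ, f (ξ t) (ξ (t + 1)) ∂(trajectoryLaw τ μ π) =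
      ∫ ξ, (∑ s', (τ (ξ t).1 (ξ t).2 s').toReal * ∑ a', (π s' a').toReal * f (ξ t) (s', a'))
        ∂(trajectoryLaw τ μ π) := by
  have key := Kernel.map_frestrictLe_trajMeasure_compProd_eq_map_trajMeasure
    (X := fun _ => S × A)
    (μ₀ := (μ.bind fun s => (π s).map fun a => (s, a)).toMeasure)
    (κ := fun n => (stepKernel τ π).comap
      (fun h : (i : Finset.Iic n) → S × A => h ⟨n, Finset.mem_Iic.2 le_rfl⟩)
      (measurable_pi_apply _)) (a := t)
  change (trajectoryLaw τ μ π).map _ ⊗ₘ _ = (trajectoryLaw τ μ π).map _ at key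
  have hg : Measurable (fun p : ((i : Finset.Iic t) → S × A) × (S × A) =>
      f (p.1 ⟨t, Finset.mem_Iic.2 le_rfl⟩) p.2) := by
    have : Measurable (fun q : (S × A) × (S × A) => f q.1 q.2) := Measurable.of_discrete
    exact this.comp (g := fun q : (S × A) × (S × A) => f q.1 q.2)
      (f := fun p : ((i : Finset.Iic t) → S × A) × (S × A) =>
        (p.1 ⟨t, Finset.mem_Iic.2 le_rfl⟩, p.2))
      (((measurable_pi_apply _).comp measurable_fst).prodMk measurable_snd)
  have hpair : Measurable (fun ξ : ℕ → S × A => (Preorder.frestrictLe (π := fun _ => S × A) t ξ,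
      ξ (t + 1))) :=
    (Preorder.measurable_frestrictLe t).prodMk (measurable_pi_apply _)
  have h1 := integral_map (μ := trajectoryLaw τ μ π) hpair.aemeasurable
    hg.aestronglyMeasurable
  refine h1.symm.trans ?_
  have hint : Integrable (fun p : ((i : Finset.Iic t) → S × A) × (S × A) =>
      f (p.1 ⟨t, Finset.mem_Iic.2 le_rfl⟩) p.2) ((trajectoryLaw τ μ π).map
        (fun ξ : ℕ → S × A => (Preorder.frestrictLe (π := fun _ => S × A) t ξ, ξ (t + 1)))) := by
    have := Measure.isProbabilityMeasure_map (μ := trajectoryLaw τ μ π) hpair.aemeasurable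
    obtain ⟨C, hC⟩ := (Set.finite_range (fun q : (S × A) × (S × A) => ‖f q.1 q.2‖)).bddAbove
    exact Integrable.of_bound hg.aestronglyMeasurable C
      (Filter.Eventually.of_forall fun p => hC ⟨(_, p.2), rfl⟩)
  rw [← key] at hint ⊢
  have := Measure.isProbabilityMeasure_map (μ := trajectoryLaw τ μ π)
    (Preorder.measurable_frestrictLe (X := fun _ => S × A) t).aemeasurable
  rw [Measure.integral_compProd hint]
  simp only [Kernel.comap_apply, integral_stepKernel]
  rw [integral_map (Preorder.measurable_frestrictLe (X := fun _ => S × A) t).aemeasurable]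
  · rfl
  · have : Measurable (fun x : S × A =>
        ∑ s', (τ x.1 x.2 s').toReal * ∑ a', (π s' a').toReal * f x (s', a')) :=
      Measurable.of_discrete
    exact (this.comp (measurable_pi_apply _)).aestronglyMeasurable

lemma integrable_trajectoryLaw (τ : Transition S A) (μ : PMF S) (π : Policy S A) (t : ℕ)
    (f : S × A → S × A → ℝ) :
    Integrable (fun ξ => f (ξ t) (ξ (t + 1))) (trajectoryLaw τ μ π) := by
  obtain ⟨C, hC⟩ := (Set.finite_range (fun q : (S × A) × (S × A) => ‖f q.1 q.2‖)).bddAbove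
  have hf : Measurable (fun q : (S × A) × (S × A) => f q.1 q.2) := Measurable.of_discrete
  have hm : Measurable (fun ξ : ℕ → S × A => f (ξ t) (ξ (t + 1))) :=
    hf.comp (g := fun q : (S × A) × (S × A) => f q.1 q.2)
      (f := fun ξ : ℕ → S × A => (ξ t, ξ (t + 1)))
      ((measurable_pi_apply _).prodMk (measurable_pi_apply _))
  exact Integrable.of_bound hm.aestronglyMeasurable C
    (Filter.Eventually.of_forall fun ξ => hC ⟨(ξ t, ξ (t + 1)), rfl⟩)

lemma exists_integral_norm_trajectoryLaw_le (τ : Transition S A) (μ : PMF S) (π : Policy S A)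
    (f : S × A → S × A → ℝ) :
    ∃ C : ℝ, ∀ t, ∫ ξ, ‖f (ξ t) (ξ (t + 1))‖ ∂(trajectoryLaw τ μ π) ≤ C := by
  obtain ⟨C, hC⟩ := (Set.finite_range (fun q : (S × A) × (S × A) => ‖f q.1 q.2‖)).bddAbove
  refine ⟨C, fun t => ?_⟩
  calc ∫ ξ, ‖f (ξ t) (ξ (t + 1))‖ ∂(trajectoryLaw τ μ π)
      ≤ ∫ _, C ∂(trajectoryLaw τ μ π) :=
        integral_mono (integrable_trajectoryLaw τ μ π t f).norm (integrable_const C)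
          fun ξ => hC ⟨(ξ t, ξ (t + 1)), rfl⟩
    _ = C := by simp

/-- The expected discounted return is the mean of any solution of the Bellman equation. -/
lemma integral_trajectoryLaw_discounted (τ : Transition S A) (μ : PMF S) (π : Policy S A)
    {γ : ℝ} (hγ0 : 0 ≤ γ) (hγ1 : γ < 1) (R : Reward S A) (h V : S → ℝ)
    (hV : ∀ s, V s =
      ∑ a, (π s a).toReal * bellmanQ τ γ (meanReward τ R) V s a + h s) :
    ∫ ξ, (∑' t : ℕ, γ ^ t * (R ((ξ t).1, (ξ t).2, (ξ (t + 1)).1) + h (ξ t).1))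
      ∂(trajectoryLaw τ μ π) = ∑ s, (μ s).toReal * V s := by
  let r : S × A → S × A → ℝ := fun x y => R (x.1, x.2, y.1) + h x.1
  -- Action value including the state bonus `h`, so that its mean under `π` is `V`.
  let U : S × A → ℝ := fun x => bellmanQ τ γ (meanReward τ R) V x.1 x.2 + h x.1
  have hU : ∀ s, ∑ a, (π s a).toReal * U (s, a) = V s := fun s => by
    simp only [U, mul_add, Finset.sum_add_distrib, PMF.sum_toReal_mul_const]
    exact (hV s).symm
  let m : ℕ → ℝ := fun t => ∫ ξ, U (ξ t) ∂(trajectoryLaw τ μ π)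
  have hUint : ∀ t, Integrable (fun ξ => U (ξ t)) (trajectoryLaw τ μ π) := fun t =>
    integrable_trajectoryLaw τ μ π t (fun x _ => U x)
  have hm0 : m 0 = ∑ s, (μ s).toReal * V s := by
    simp only [m, integral_trajectoryLaw_zero, hU]
  have hm1 : ∀ t, m (t + 1) =
      ∫ ξ, (∑ s', (τ (ξ t).1 (ξ t).2 s').toReal * V s') ∂(trajectoryLaw τ μ π) := fun t => by
    simp only [m]
    rw [integral_trajectoryLaw_succ τ μ π t (fun _ y => U y)]
    simp only [hU]
  -- The Bellman equation makes the discounted expected rewards telescope.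
  have he : ∀ t, ∫ ξ, r (ξ t) (ξ (t + 1)) ∂(trajectoryLaw τ μ π) = m t - γ * m (t + 1) := by
    intro t
    rw [integral_trajectoryLaw_succ, hm1, ← integral_const_mul, ← integral_sub (hUint t)]
    · congr 1
      ext ξ
      simp only [r, U, bellmanQ, meanReward, PMF.sum_toReal_mul_const, mul_add,
        Finset.sum_add_distrib]
      ring
    · exact (integrable_trajectoryLaw τ μ π t
        (fun x _ => ∑ s', (τ x.1 x.2 s').toReal * V s')).const_mul γ
  obtain ⟨C, hC⟩ := exists_integral_norm_trajectoryLaw_le τ μ π r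
  obtain ⟨D, hD⟩ := exists_integral_norm_trajectoryLaw_le τ μ π (fun x _ => U x)
  have hsum : Summable fun t : ℕ => γ ^ t * C :=
    (summable_geometric_of_lt_one hγ0 hγ1).mul_right C
  have hs := hasSum_integral_of_summable_integral_norm (μ := trajectoryLaw τ μ π)
    (F := fun (t : ℕ) ξ => γ ^ t * r (ξ t) (ξ (t + 1)))
    (fun t => (integrable_trajectoryLaw τ μ π t r).const_mul _)
    (by
      refine Summable.of_nonneg_of_le (fun t => integral_nonneg fun ξ => norm_nonneg _)
        (fun t => ?_) hsum
      simp only [norm_mul, norm_pow, Real.norm_eq_abs, abs_of_nonneg hγ0]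
      rw [integral_const_mul]
      exact mul_le_mul_of_nonneg_left (hC t) (pow_nonneg hγ0 t))
  have hpart : ∀ n, ∑ t ∈ Finset.range n,
      ∫ ξ, γ ^ t * r (ξ t) (ξ (t + 1)) ∂(trajectoryLaw τ μ π) = m 0 - γ ^ n * m n := by
    intro n
    simp only [integral_const_mul, he]
    rw [← one_mul (m 0), ← pow_zero γ, ← Finset.sum_range_sub' (fun t => γ ^ t * m t) n]
    refine Finset.sum_congr rfl fun t _ => ?_
    ring
  have hlim : Filter.Tendsto (fun n => m 0 - γ ^ n * m n) Filter.atTop (nhds (m 0)) := by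
    have h0 : Filter.Tendsto (fun n : ℕ => γ ^ n * m n) Filter.atTop (nhds 0) := by
      refine squeeze_zero_norm (a := fun n : ℕ => γ ^ n * D) (fun n => ?_) ?_
      · rw [norm_mul, norm_pow, Real.norm_eq_abs, abs_of_nonneg hγ0]
        exact mul_le_mul_of_nonneg_left ((norm_integral_le_integral_norm _).trans (hD n))
          (pow_nonneg hγ0 n)
      · simpa using (tendsto_pow_atTop_nhds_zero_of_lt_one hγ0 hγ1).mul_const D
    simpa using tendsto_const_nhds.sub h0
  have ht := hs.tendsto_sum_nat
  simp only [hpart] at ht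
  rw [← hm0]
  exact tendsto_nhds_unique ht hlim

end Chain

lemma trajectoryExpectation_discounted (τ : Transition S A) (μ : PMF S) (π : Policy S A)
    {γ : ℝ} (hγ0 : 0 ≤ γ) (hγ1 : γ < 1) (R : Reward S A) (h V : S → ℝ)
    (hV : ∀ s, V s =
      ∑ a, (π s a).toReal * bellmanQ τ γ (meanReward τ R) V s a + h s) :
    trajectoryExpectation τ μ π
      (fun ξ => ∑' t : ℕ, γ ^ t * (R ((ξ t).1, (ξ t).2, (ξ (t + 1)).1) + h (ξ t).1)) =
      ∑ s, (μ s).toReal * V s := by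
  let _ : MeasurableSpace S := ⊤
  let _ : MeasurableSpace A := ⊤
  have : DiscreteMeasurableSpace S := ⟨fun _ => trivial⟩
  have : DiscreteMeasurableSpace A := ⟨fun _ => trivial⟩
  exact integral_trajectoryLaw_discounted τ μ π hγ0 hγ1 R h V hV

end Trajectories

/-! ### Bellman equations for translative aggregators -/

section Bellman

variable {S A : Type*} [Fintype S]

/-- Monotone functionals that commute with the addition of constants. -/
structure IsTranslative (F : (A → ℝ) → ℝ) : Prop where
  mono : ∀ q q' : A → ℝ, (∀ a, q a ≤ q' a) → F q ≤ F q'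
  add_const : ∀ (q : A → ℝ) (c : ℝ), F (fun a => q a + c) = F q + c

lemma bellmanQ_mono (τ : Transition S A) {γ : ℝ} (hγ0 : 0 ≤ γ) (r : S → A → ℝ) {V W : S → ℝ}
    (h : ∀ s, V s ≤ W s) (s : S) (a : A) : bellmanQ τ γ r V s a ≤ bellmanQ τ γ r W s a := by
  unfold bellmanQ
  gcongr
  exact h _

lemma bellmanQ_add_const (τ : Transition S A) (γ : ℝ) (r : S → A → ℝ) (V : S → ℝ) (c : ℝ)
    (s : S) (a : A) :
    bellmanQ τ γ r (fun s => V s + c) s a = bellmanQ τ γ r V s a + γ * c := by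
  simp only [bellmanQ, mul_add, Finset.sum_add_distrib, PMF.sum_toReal_mul_const]
  ring

/-- Blackwell's argument: a constant passes through the backup, shrunk by the factor `γ`. -/
lemma IsTranslative.bellman_le {F : (A → ℝ) → ℝ} (hF : IsTranslative F) (τ : Transition S A)
    {γ : ℝ} (hγ0 : 0 ≤ γ) (r : S → A → ℝ) {V W : S → ℝ} {c : ℝ} (h : ∀ s, V s ≤ W s + c) (s : S) :
    F (bellmanQ τ γ r V s) ≤ F (bellmanQ τ γ r W s) + γ * c := by
  rw [← hF.add_const]
  exact hF.mono _ _ fun a =>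
    (bellmanQ_mono τ hγ0 r h s a).trans_eq (bellmanQ_add_const τ γ r W c s a)

/-- A subsolution of a Bellman equation lies below any supersolution. -/
lemma le_of_bellman {F : S → (A → ℝ) → ℝ} (hF : ∀ s, IsTranslative (F s)) (τ : Transition S A)
    {γ : ℝ} (hγ0 : 0 ≤ γ) (hγ1 : γ < 1) (r : S → A → ℝ) {V W : S → ℝ}
    (hV : ∀ s, V s ≤ F s (bellmanQ τ γ r V s)) (hW : ∀ s, F s (bellmanQ τ γ r W s) ≤ W s)
    (s : S) : V s ≤ W s := by
  have : Nonempty S := ⟨s⟩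
  -- The largest gap `δ` satisfies `δ ≤ γ * δ`, hence `δ ≤ 0`.
  obtain ⟨s₀, hs₀⟩ := Finite.exists_max fun s => V s - W s
  have h1 := (hF s₀).bellman_le τ hγ0 r (V := V) (W := W) (c := V s₀ - W s₀)
    (fun s => by linarith [hs₀ s]) s₀
  have h2 : V s₀ - W s₀ ≤ 0 := by nlinarith [hV s₀, hW s₀]
  linarith [hs₀ s]

/-- Banach's theorem in the sup norm. Since `F` is arbitrary, this serves policy evaluation, the
optimality equation and its entropy-regularised form alike. -/
lemma exists_bellman_fixedPoint {F : S → (A → ℝ) → ℝ} (hF : ∀ s, IsTranslative (F s))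
    (τ : Transition S A) {γ : ℝ} (hγ0 : 0 ≤ γ) (hγ1 : γ < 1) (r : S → A → ℝ) :
    ∃ V : S → ℝ, ∀ s, V s = F s (bellmanQ τ γ r V s) := by
  let T : (S → ℝ) → S → ℝ := fun V s => F s (bellmanQ τ γ r V s)
  have hle : ∀ (V W : S → ℝ) (s : S), T V s - T W s ≤ γ * dist V W := fun V W s => by
    have := (hF s).bellman_le τ hγ0 r (V := V) (W := W) (c := dist V W)
      (fun s' => by
        have := (le_abs_self _).trans ((Real.dist_eq (V s') (W s')).symm.le.trans
          (dist_le_pi_dist V W s'))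
        linarith) s
    simp only [T]
    linarith
  have hT : ContractingWith ⟨γ, hγ0⟩ T := by
    refine ⟨by exact_mod_cast hγ1, LipschitzWith.of_dist_le_mul fun V W => ?_⟩
    refine (dist_pi_le_iff (mul_nonneg hγ0 dist_nonneg)).2 fun s => ?_
    rw [Real.dist_eq, abs_le]
    have h1 := hle V W s
    have h2 := hle W V s
    rw [dist_comm W V] at h2
    exact ⟨by linarith, h1⟩
  exact ⟨hT.fixedPoint T, fun s => (congrFun hT.fixedPoint_isFixedPt s).symm⟩

/-- If optimal action values differ by a function of the state, the mean rewards differ by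
potential shaping. -/
lemma meanReward_eq_of_bellmanQ_eq_add {F : S → (A → ℝ) → ℝ} (hF : ∀ s, IsTranslative (F s))
    (τ : Transition S A) (γ : ℝ) {r₁ r₂ : S → A → ℝ} {V₁ V₂ c : S → ℝ}
    (h₁ : ∀ s, V₁ s = F s (bellmanQ τ γ r₁ V₁ s)) (h₂ : ∀ s, V₂ s = F s (bellmanQ τ γ r₂ V₂ s))
    (h : ∀ s a, bellmanQ τ γ r₂ V₂ s a = bellmanQ τ γ r₁ V₁ s a + c s) (s : S) (a : A) :
    r₂ s a = r₁ s a + c s - γ * ∑ s', (τ s a s').toReal * c s' := by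
  have hV : ∀ s, V₂ s = V₁ s + c s := fun s => by
    rw [h₂ s, h₁ s, ← (hF s).add_const]
    exact congrArg _ (funext fun a => h s a)
  have := h s a
  simp only [bellmanQ, hV, mul_add, Finset.sum_add_distrib] at this
  linarith

variable [Fintype A]

lemma IsTranslative.mean (p : PMF A) (c : ℝ) :
    IsTranslative fun q : A → ℝ => ∑ a, (p a).toReal * q a + c where
  mono q q' h := by
    gcongr
    exact h _
  add_const q d := by
    simp only [mul_add, Finset.sum_add_distrib, PMF.sum_toReal_mul_const]
    ring

/-- The telescoping computation applies to whichever solution is given, so uniqueness of the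
solution comes for free. -/
lemma valueFn_eq (τ : Transition S A) {γ : ℝ} (hγ0 : 0 ≤ γ) (hγ1 : γ < 1) (R : Reward S A)
    (π : Policy S A) {V : S → ℝ}
    (hV : ∀ s, V s = ∑ a, (π s a).toReal * bellmanQ τ γ (meanReward τ R) V s a) :
    valueFn τ γ R π = V := by
  ext s
  have := trajectoryExpectation_discounted τ (PMF.pure s) π hγ0 hγ1 R (fun _ => 0) V
    (fun s => by rw [add_zero]; exact hV s)
  simp only [add_zero, PMF.sum_toReal_pure_mul] at this
  exact this

lemma qFn_eq_bellmanQ (τ : Transition S A) (γ : ℝ) (R : Reward S A) (π : Policy S A) (s : S)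
    (a : A) : qFn τ γ R π s a = bellmanQ τ γ (meanReward τ R) (valueFn τ γ R π) s a := by
  simp only [qFn, bellmanQ, meanReward, mul_add, Finset.sum_add_distrib, Finset.mul_sum]
  congr 1
  exact Finset.sum_congr rfl fun s' _ => by ring

lemma valueFn_bellman (τ : Transition S A) {γ : ℝ} (hγ0 : 0 ≤ γ) (hγ1 : γ < 1) (R : Reward S A)
    (π : Policy S A) (s : S) : valueFn τ γ R π s =
      ∑ a, (π s a).toReal * bellmanQ τ γ (meanReward τ R) (valueFn τ γ R π) s a := by
  obtain ⟨V, hV⟩ := exists_bellman_fixedPoint (fun s => IsTranslative.mean (π s) 0) τ hγ0 hγ1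
    (meanReward τ R)
  simp only [add_zero] at hV
  rw [valueFn_eq τ hγ0 hγ1 R π hV]
  exact hV s

variable [Nonempty A]

lemma IsTranslative.sup' :
    IsTranslative fun q : A → ℝ => Finset.univ.sup' Finset.univ_nonempty q where
  mono q q' h := Finset.sup'_mono_fun fun a _ => h a
  add_const q c := by
    apply le_antisymm
    · refine Finset.sup'_le _ _ fun a ha => ?_
      have := Finset.le_sup' q ha
      linarith
    · obtain ⟨a, ha, h⟩ := Finset.exists_mem_eq_sup' Finset.univ_nonempty q
      rw [h]
      exact Finset.le_sup' (fun a => q a + c) ha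

/-- The optimal action values solve the Bellman optimality equation. -/
lemma optimalQ_eq_bellmanQ (τ : Transition S A) {γ : ℝ} (hγ0 : 0 ≤ γ) (hγ1 : γ < 1)
    (R : Reward S A) {V : S → ℝ}
    (hV : ∀ s, V s =
      Finset.univ.sup' Finset.univ_nonempty (bellmanQ τ γ (meanReward τ R) V s)) :
    optimalQ τ γ R = bellmanQ τ γ (meanReward τ R) V := by
  -- A mean is at most a maximum, so every policy value is a subsolution of the optimality equation.
  have hle : ∀ π s, valueFn τ γ R π s ≤ V s := fun π =>
    le_of_bellman (fun _ => IsTranslative.sup') τ hγ0 hγ1 (meanReward τ R)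
      (fun s => by
        rw [valueFn_bellman τ hγ0 hγ1 R π s, ← PMF.sum_toReal_mul_const (π s)
          (Finset.univ.sup' Finset.univ_nonempty
            (bellmanQ τ γ (meanReward τ R) (valueFn τ γ R π) s))]
        gcongr
        exact Finset.le_sup' (bellmanQ τ γ (meanReward τ R) (valueFn τ γ R π) s)
          (Finset.mem_univ _))
      (fun s => (hV s).symm.le)
  -- The deterministic greedy policy has value `V`, so it attains the supremum at every state and
  -- action.
  have hgreedy : ∀ s, ∃ a, V s = bellmanQ τ γ (meanReward τ R) V s a := fun s => by
    obtain ⟨a, -, h⟩ := Finset.exists_mem_eq_sup' Finset.univ_nonempty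
      (bellmanQ τ γ (meanReward τ R) V s)
    exact ⟨a, (hV s).trans h⟩
  choose act hact using hgreedy
  have hopt : valueFn τ γ R (fun s => PMF.pure (act s)) = V :=
    valueFn_eq τ hγ0 hγ1 R _ fun s => by rw [PMF.sum_toReal_pure_mul, ← hact]
  ext s a
  have hq : ∀ π, qFn τ γ R π s a ≤ bellmanQ τ γ (meanReward τ R) V s a := fun π => by
    rw [qFn_eq_bellmanQ]
    exact bellmanQ_mono τ hγ0 _ (hle π) s a
  refine le_antisymm (ciSup_le hq) ?_
  rw [← hopt, ← qFn_eq_bellmanQ]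
  exact le_ciSup (f := fun π => qFn τ γ R π s a) ⟨_, Set.forall_mem_range.2 hq⟩ _

end Bellman

/-! ### Softmax and the Gibbs variational principle -/

section Softmax

variable {A : Type*} [Fintype A]

/-- The smooth maximum `α log ∑ exp (q / α)`. -/
def smoothMax (α : ℝ) (q : A → ℝ) : ℝ := α * Real.log (∑ a, Real.exp (q a / α))

/-- The sum multiplied by `α` on the right is minus the Kullback–Leibler divergence of `p` from the
distribution proportional to `exp (q / α)`. -/
lemma gibbs_sum_eq {α : ℝ} (hα : 0 < α) (q : A → ℝ) (p : PMF A) :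
    ∑ a, (p a).toReal * q a + α * shannonEntropy p =
      smoothMax α q + α * ∑ a, ((p a).toReal *
        (q a / α - Real.log (∑ b, Real.exp (q b / α))) + Real.negMulLog (p a).toReal) := by
  simp only [Finset.sum_add_distrib, mul_sub, Finset.sum_sub_distrib, PMF.sum_toReal_mul_const,
    smoothMax, shannonEntropy, mul_add, Finset.mul_sum]
  have : ∀ a, α * ((p a).toReal * (q a / α)) = (p a).toReal * q a := fun a => by
    field_simp
  simp only [this]
  ring

variable [Nonempty A]

/-- The distribution proportional to `exp q`. -/
def softmax (q : A → ℝ) : PMF A :=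
  PMF.normalize (fun a => ENNReal.ofReal (Real.exp (q a)))
    (by
      rw [tsum_fintype]
      intro h
      have h0 := (Finset.sum_eq_zero_iff.1 h) (Classical.arbitrary A) (Finset.mem_univ _)
      exact absurd (ENNReal.ofReal_eq_zero.1 h0) (not_le.2 (Real.exp_pos _)))
    (by
      rw [tsum_fintype]
      exact ENNReal.sum_ne_top.2 fun _ _ => ENNReal.ofReal_ne_top)

lemma sum_exp_pos (q : A → ℝ) : 0 < ∑ a, Real.exp (q a) :=
  Finset.sum_pos (fun _ _ => Real.exp_pos _) Finset.univ_nonempty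

lemma softmax_toReal (q : A → ℝ) (a : A) :
    (softmax q a).toReal = Real.exp (q a - Real.log (∑ b, Real.exp (q b))) := by
  rw [softmax, PMF.normalize_apply, tsum_fintype, ← ENNReal.ofReal_sum_of_nonneg
    fun b _ => (Real.exp_pos _).le, ENNReal.toReal_mul, ENNReal.toReal_inv,
    ENNReal.toReal_ofReal (Real.exp_pos _).le, ENNReal.toReal_ofReal (sum_exp_pos q).le,
    Real.exp_sub, Real.exp_log (sum_exp_pos q), div_eq_mul_inv]

/-- The constant is the difference of the log-normalisers. -/
lemma eq_add_of_softmax_eq {q₁ q₂ : A → ℝ} (h : softmax q₁ = softmax q₂) :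
    ∃ c, ∀ a, q₂ a = q₁ a + c := by
  refine ⟨Real.log (∑ b, Real.exp (q₂ b)) - Real.log (∑ b, Real.exp (q₁ b)), fun a => ?_⟩
  have := congrArg (fun p : PMF A => (p a).toReal) h
  simp only [softmax_toReal, Real.exp_eq_exp] at this
  linarith

/-- This is `1 + x ≤ exp x` at `x = l - log p`. With `l` a log-probability, the right-hand sides sum
to zero, which gives nonnegativity of the divergence. -/
lemma mul_add_negMulLog_le {p : ℝ} (hp : 0 ≤ p) (l : ℝ) :
    p * l + Real.negMulLog p ≤ Real.exp l - p := by
  rcases hp.eq_or_lt with rfl | hp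
  · simpa using (Real.exp_pos l).le
  · have := Real.add_one_le_exp (l - Real.log p)
    rw [Real.exp_sub, Real.exp_log hp, le_div_iff₀ hp] at this
    rw [Real.negMulLog]
    nlinarith

lemma eq_of_mul_add_negMulLog_eq {p : ℝ} (hp : 0 ≤ p) {l : ℝ}
    (h : p * l + Real.negMulLog p = Real.exp l - p) : p = Real.exp l := by
  rcases hp.eq_or_lt with rfl | hp
  · have := Real.exp_pos l
    simp at h
    linarith
  · by_contra hne
    have hne' : l - Real.log p ≠ 0 := fun h0 => hne (by
      rw [sub_eq_zero.1 h0, Real.exp_log hp])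
    have := Real.add_one_lt_exp hne'
    rw [Real.exp_sub, Real.exp_log hp, lt_div_iff₀ hp] at this
    rw [Real.negMulLog] at h
    nlinarith

lemma IsTranslative.smoothMax {α : ℝ} (hα : 0 < α) :
    IsTranslative (smoothMax α : (A → ℝ) → ℝ) where
  mono q q' h := by
    unfold _root_.smoothMax
    have := sum_exp_pos fun a => q a / α
    gcongr
    exact h _
  add_const q c := by
    unfold _root_.smoothMax
    simp only [add_div, Real.exp_add]
    rw [← Finset.sum_mul, Real.log_mul (sum_exp_pos _).ne' (Real.exp_pos _).ne', Real.log_exp,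
      mul_add, mul_div_cancel₀ _ hα.ne']

/-- The Gibbs variational inequality. -/
lemma gibbs_le {α : ℝ} (hα : 0 < α) (q : A → ℝ) (p : PMF A) :
    ∑ a, (p a).toReal * q a + α * shannonEntropy p ≤ smoothMax α q := by
  rw [gibbs_sum_eq hα]
  have h : ∑ a, ((p a).toReal * (q a / α - Real.log (∑ b, Real.exp (q b / α))) +
      Real.negMulLog (p a).toReal) ≤
      ∑ a, ((softmax (fun a => q a / α) a).toReal - (p a).toReal) :=
    Finset.sum_le_sum fun a _ => by
      rw [softmax_toReal]
      exact mul_add_negMulLog_le ENNReal.toReal_nonneg _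
  rw [Finset.sum_sub_distrib, PMF.sum_toReal_eq_one, PMF.sum_toReal_eq_one, sub_self] at h
  nlinarith

lemma gibbs_softmax {α : ℝ} (hα : 0 < α) (q : A → ℝ) :
    ∑ a, (softmax (fun a => q a / α) a).toReal * q a +
      α * shannonEntropy (softmax fun a => q a / α) = smoothMax α q := by
  rw [gibbs_sum_eq hα]
  simp [softmax_toReal, Real.negMulLog]

/-- Equality in the summed bound forces it in each term, where strict convexity of `exp` fixes the
probability. -/
lemma eq_softmax_of_gibbs_eq {α : ℝ} (hα : 0 < α) (q : A → ℝ) (p : PMF A)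
    (h : ∑ a, (p a).toReal * q a + α * shannonEntropy p = smoothMax α q) :
    p = softmax fun a => q a / α := by
  rw [gibbs_sum_eq hα] at h
  have h0 : ∑ a, ((p a).toReal * (q a / α - Real.log (∑ b, Real.exp (q b / α))) +
      Real.negMulLog (p a).toReal) =
      ∑ a, ((softmax (fun a => q a / α) a).toReal - (p a).toReal) := by
    rw [Finset.sum_sub_distrib, PMF.sum_toReal_eq_one, PMF.sum_toReal_eq_one, sub_self]
    have : α * ∑ a, ((p a).toReal * (q a / α - Real.log (∑ b, Real.exp (q b / α))) +
      Real.negMulLog (p a).toReal) = 0 := by linarith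
    exact (mul_eq_zero.1 this).resolve_left hα.ne'
  ext a
  have := (Finset.sum_eq_sum_iff_of_le fun a _ => by
      rw [softmax_toReal]
      exact mul_add_negMulLog_le ENNReal.toReal_nonneg _).1 h0 a (Finset.mem_univ a)
  rw [softmax_toReal] at this
  rw [← ENNReal.toReal_eq_toReal_iff' (p.apply_ne_top a) (PMF.apply_ne_top _ a), softmax_toReal]
  exact eq_of_mul_add_negMulLog_eq ENNReal.toReal_nonneg this

end Softmax

/-! ### Equal policies give equal shaping classes -/

section Policies

variable {S A : Type*} [Fintype S]

/-- Shaping `R₁` with potential `-c` gives the mean rewards of `R₂`; redistribution absorbs the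
rest. -/
lemma mem_shapingClass_of_meanReward (τ : Transition S A) (γ : ℝ) {R₁ R₂ : Reward S A}
    (c : S → ℝ) (h : ∀ s a, meanReward τ R₂ s a =
      meanReward τ R₁ s a + c s - γ * ∑ s', (τ s a s').toReal * c s') :
    R₂ ∈ shapingClass τ γ R₁ := by
  refine ⟨WithLp.toLp 2 fun x => R₁ x + γ * (-c x.2.2) - (-c x.1), ⟨fun s => -c s, ?_⟩, ?_⟩
  · intro s a s'
    rfl
  · intro s a
    have := h s a
    simp only [meanReward] at this
    rw [this]
    simp only [mul_sub, mul_add, mul_neg, Finset.sum_sub_distrib, Finset.sum_add_distrib,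
      Finset.sum_neg_distrib, PMF.sum_toReal_mul_const, Finset.mul_sum]
    rw [show ∑ s', (τ s a s').toReal * (γ * c s') = ∑ s', γ * ((τ s a s').toReal * c s') from
      Finset.sum_congr rfl fun _ _ => by ring]
    ring

variable [Fintype A]

lemma causalEntropyObjective_eq (τ : Transition S A) (μ₀ : PMF S) {γ : ℝ} (hγ0 : 0 ≤ γ)
    (hγ1 : γ < 1) (α : ℝ) (R : Reward S A) (π : Policy S A) {V : S → ℝ}
    (hV : ∀ s, V s = ∑ a, (π s a).toReal * bellmanQ τ γ (meanReward τ R) V s a +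
      α * shannonEntropy (π s)) :
    causalEntropyObjective τ μ₀ γ α R π = ∑ s, (μ₀ s).toReal * V s :=
  trajectoryExpectation_discounted τ μ₀ π hγ0 hγ1 R (fun s => α * shannonEntropy (π s)) V hV

variable [Nonempty A]

/-- The maximal causal entropy policy is the softmax of the soft-optimal action values. -/
lemma maxCausalEntropy_eq_softmax (τ : Transition S A) {μ₀ : PMF S} (hreach : AllReachable τ μ₀)
    {γ : ℝ} (hγ0 : 0 < γ) (hγ1 : γ < 1) {α : ℝ} (hα : 0 < α) (R : Reward S A) {V : S → ℝ}
    (hV : ∀ s, V s = smoothMax α (bellmanQ τ γ (meanReward τ R) V s)) :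
    maxCausalEntropy τ μ₀ γ α R =
      fun s => softmax fun a => bellmanQ τ γ (meanReward τ R) V s a / α := by
  let r := meanReward τ R
  have hval : ∀ π : Policy S A, ∃ W : S → ℝ, (∀ s, W s =
      ∑ a, (π s a).toReal * bellmanQ τ γ r W s a + α * shannonEntropy (π s)) ∧
      (∀ s, W s ≤ V s) ∧
      causalEntropyObjective τ μ₀ γ α R π = ∑ s, (μ₀ s).toReal * W s := fun π => by
    obtain ⟨W, hW⟩ := exists_bellman_fixedPoint
      (fun s => IsTranslative.mean (π s) (α * shannonEntropy (π s))) τ hγ0.le hγ1 r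
    refine ⟨W, hW, ?_, causalEntropyObjective_eq τ μ₀ hγ0.le hγ1 α R π hW⟩
    refine le_of_bellman (fun _ => IsTranslative.smoothMax hα) τ hγ0.le hγ1 r (fun s => ?_)
      (fun s => (hV s).symm.le)
    exact (hW s).trans_le (gibbs_le hα _ _)
  have hsoft : causalEntropyObjective τ μ₀ γ α R
      (fun s => softmax fun a => bellmanQ τ γ r V s a / α) = ∑ s, (μ₀ s).toReal * V s :=
    causalEntropyObjective_eq τ μ₀ hγ0.le hγ1 α R _ fun s =>
      (hV s).trans (gibbs_softmax hα _).symm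
  have hmax : IsMCEPolicy τ μ₀ γ α R (fun s => softmax fun a => bellmanQ τ γ r V s a / α) := by
    intro π
    obtain ⟨W, -, hWV, hJ⟩ := hval π
    rw [hJ, hsoft]
    gcongr
    exact hWV _
  have hspec : IsMCEPolicy τ μ₀ γ α R (maxCausalEntropy τ μ₀ γ α R) :=
    Classical.epsilon_spec ⟨_, hmax⟩
  -- Only maximality of the chosen policy is kept: what follows proves that any maximiser is the
  -- softmax policy.
  generalize maxCausalEntropy τ μ₀ γ α R = π at hspec
  obtain ⟨W, hW, hWV, hJ⟩ := hval π
  have hopt := hspec fun s => softmax fun a => bellmanQ τ γ r V s a / α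
  rw [hJ, hsoft] at hopt
  have hinit : ∀ s, μ₀ s ≠ 0 → W s = V s := fun s hs => by
    have h := (Finset.sum_eq_sum_iff_of_le fun s _ =>
      mul_le_mul_of_nonneg_left (hWV s) (ENNReal.toReal_nonneg (a := μ₀ s))).1
      (le_antisymm (Finset.sum_le_sum fun s _ =>
        mul_le_mul_of_nonneg_left (hWV s) ENNReal.toReal_nonneg) hopt) s (Finset.mem_univ s)
    exact mul_left_cancel₀ (ENNReal.toReal_ne_zero.2 ⟨hs, μ₀.apply_ne_top s⟩) h
  -- At a state where `π` is optimal, both inequalities `W s ≤ V s` passes through, Gibbs and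
  -- monotonicity of the backup, are equalities.
  have hloc : ∀ s, W s = V s → π s = (softmax fun a => bellmanQ τ γ r V s a / α) ∧
      ∑ a, (π s a).toReal * bellmanQ τ γ r W s a =
        ∑ a, (π s a).toReal * bellmanQ τ γ r V s a := fun s hs => by
    have h1 : ∑ a, (π s a).toReal * bellmanQ τ γ r W s a ≤
        ∑ a, (π s a).toReal * bellmanQ τ γ r V s a := by
      gcongr
      exact bellmanQ_mono τ hγ0.le r hWV _ _
    have h2 := gibbs_le hα (bellmanQ τ γ r V s) (π s)
    have h3 := hW s
    rw [hs, hV s] at h3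
    exact ⟨eq_softmax_of_gibbs_eq hα _ _ (by linarith), by linarith⟩
  -- A softmax charges every action, so with `0 < γ` optimality spreads to each possible successor,
  -- and by reachability to all states.
  have hstep : ∀ s s', W s = V s → (∃ a, τ s a s' ≠ 0) → W s' = V s' := by
    rintro s s' hs ⟨a, ha⟩
    obtain ⟨hπ, hsum⟩ := hloc s hs
    have h1 := (Finset.sum_eq_sum_iff_of_le fun a _ => mul_le_mul_of_nonneg_left
      (bellmanQ_mono τ hγ0.le r hWV s a) (ENNReal.toReal_nonneg (a := π s a))).1 hsum a
      (Finset.mem_univ a)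
    have hpos : (π s a).toReal ≠ 0 := by
      rw [hπ, softmax_toReal]
      exact (Real.exp_pos _).ne'
    have h2 := mul_left_cancel₀ hpos h1
    have h3 := mul_left_cancel₀ hγ0.ne' (add_left_cancel h2)
    have h4 := (Finset.sum_eq_sum_iff_of_le fun s' _ => mul_le_mul_of_nonneg_left
      (hWV s') (ENNReal.toReal_nonneg (a := τ s a s'))).1 h3 s' (Finset.mem_univ s')
    exact mul_left_cancel₀ (ENNReal.toReal_ne_zero.2 ⟨ha, (τ s a).apply_ne_top s'⟩) h4
  have hall : ∀ s, W s = V s := fun s => by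
    obtain ⟨s₀, h0, hpath⟩ := hreach s
    induction hpath with
    | refl => exact hinit _ h0
    | tail _ hbc ih => exact hstep _ _ ih hbc
  exact funext fun s => (hloc s (hall s)).1

/-- Rewards with the same Boltzmann-rational policy differ by potential shaping and
`S'`-redistribution. -/
lemma mem_shapingClass_of_boltzmannRational_eq (τ : Transition S A) {γ : ℝ} (hγ0 : 0 < γ)
    (hγ1 : γ < 1) {β : ℝ} (hβ : 0 < β) {R₁ R₂ : Reward S A}
    (h : boltzmannRational τ γ β R₁ = boltzmannRational τ γ β R₂) :
    R₂ ∈ shapingClass τ γ R₁ := by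
  have hF : ∀ _ : S, IsTranslative fun q : A → ℝ => Finset.univ.sup' Finset.univ_nonempty q :=
    fun _ => IsTranslative.sup'
  obtain ⟨V₁, hV₁⟩ := exists_bellman_fixedPoint hF τ hγ0.le hγ1 (meanReward τ R₁)
  obtain ⟨V₂, hV₂⟩ := exists_bellman_fixedPoint hF τ hγ0.le hγ1 (meanReward τ R₂)
  have hb : ∀ R, boltzmannRational τ γ β R = fun s => softmax fun a => β * optimalQ τ γ R s a :=
    fun _ => rfl
  rw [hb, hb, optimalQ_eq_bellmanQ τ hγ0.le hγ1 R₁ hV₁,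
    optimalQ_eq_bellmanQ τ hγ0.le hγ1 R₂ hV₂] at h
  choose c hc using fun s => eq_add_of_softmax_eq (congrFun h s)
  -- The logits are `β` times the action values, hence the division.
  refine mem_shapingClass_of_meanReward τ γ (fun s => c s / β) fun s a =>
    meanReward_eq_of_bellmanQ_eq_add hF τ γ hV₁ hV₂ (c := fun s => c s / β) (fun s a => ?_) s a
  have := hc s a
  field_simp
  linarith

/-- Rewards with the same maximal causal entropy policy differ by potential shaping and
`S'`-redistribution. -/
lemma mem_shapingClass_of_maxCausalEntropy_eq (τ : Transition S A) {μ₀ : PMF S}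
    (hreach : AllReachable τ μ₀) {γ : ℝ} (hγ0 : 0 < γ) (hγ1 : γ < 1) {α : ℝ} (hα : 0 < α)
    {R₁ R₂ : Reward S A} (h : maxCausalEntropy τ μ₀ γ α R₁ = maxCausalEntropy τ μ₀ γ α R₂) :
    R₂ ∈ shapingClass τ γ R₁ := by
  have hF : ∀ _ : S, IsTranslative (smoothMax α : (A → ℝ) → ℝ) :=
    fun _ => IsTranslative.smoothMax hα
  obtain ⟨V₁, hV₁⟩ := exists_bellman_fixedPoint hF τ hγ0.le hγ1 (meanReward τ R₁)
  obtain ⟨V₂, hV₂⟩ := exists_bellman_fixedPoint hF τ hγ0.le hγ1 (meanReward τ R₂)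
  rw [maxCausalEntropy_eq_softmax τ hreach hγ0 hγ1 hα R₁ hV₁,
    maxCausalEntropy_eq_softmax τ hreach hγ0 hγ1 hα R₂ hV₂] at h
  choose c hc using fun s => eq_add_of_softmax_eq (congrFun h s)
  refine mem_shapingClass_of_meanReward τ γ (fun s => α * c s) fun s a =>
    meanReward_eq_of_bellmanQ_eq_add hF τ γ hV₁ hV₂ (c := fun s => α * c s) (fun s a => ?_) s a
  have := hc s a
  field_simp at this
  linarith

end Policies

/-! ### Robustness as a formal consequence -/

section Robustness

variable {S A : Type*}

/-- Robustness for a behavioural model whose values determine rewards up to distance zero. -/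
lemma isRobust_iff_of_congr {d : Reward S A → Reward S A → ℝ} {ε : ℝ} (hε : 0 ≤ ε)
    (hself : ∀ R, d R R = 0) (hcomm : ∀ R R', d R R' = d R' R) {f : Reward S A → Policy S A}
    (hf : ∀ R₁ R₂, f R₁ = f R₂ → ∀ R, d R R₁ = d R R₂)
    (Rhat : Set (Reward S A)) (g : Rhat → Policy S A) :
    IsRobust Rhat d ε (fun R : Rhat => f R) g ↔
      ∃ t ∈ {t | ∀ R, d R (t R) ≤ ε} ∩ preserving Rhat,
        (g = fun R : Rhat => f (t R)) ∧ (fun R : Rhat => f R) ≠ g := by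
  classical
  constructor
  · intro h
    choose u hu using fun R : Rhat => h.range_subset ⟨R, rfl⟩
    -- Off `Rhat` the identity is harmless, because `d R R = 0 ≤ ε`.
    let t : Reward S A → Reward S A := fun R => if hR : R ∈ Rhat then u ⟨R, hR⟩ else R
    have ht : ∀ R : Rhat, t R = u R := fun R => dif_pos R.2
    refine ⟨t, ⟨fun R => ?_, fun R hR => ?_⟩, ?_, h.ne⟩
    · by_cases hR : R ∈ Rhat
      · rw [ht ⟨R, hR⟩, hcomm]
        exact h.dist_le_of_eq _ ⟨R, hR⟩ (hu ⟨R, hR⟩)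
      · rw [show t R = R from dif_neg hR, hself]
        exact hε
    · rw [ht ⟨R, hR⟩]
      exact (u ⟨R, hR⟩).2
    · ext1 R
      rw [ht]
      exact (hu R).symm
  · rintro ⟨t, ⟨ht, htR⟩, rfl, hne⟩
    refine ⟨fun R₁ R₂ h => ?_, fun R₁ R₂ h => ?_, ?_, hne⟩
    · rw [hcomm, hf _ _ h]
      exact ht R₂
    · rw [← hf _ _ h, hself]
      exact hε
    · rintro _ ⟨R, rfl⟩
      exact ⟨⟨t R, htR R R.2⟩, rfl⟩

end Robustness

/-! ### Canonicalisation as orthogonal projection -/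

section Starc

open scoped InnerProductSpace

variable {S A : Type*}

/-- The reward added by shaping with a potential. -/
def shapingReward (γ : ℝ) : (S → ℝ) →ₗ[ℝ] Reward S A where
  toFun Φ := WithLp.toLp 2 fun x => γ * Φ x.2.2 - Φ x.1
  map_add' Φ Ψ := by
    ext x
    simp only [Pi.add_apply, PiLp.add_apply]
    ring
  map_smul' c Φ := by
    ext x
    simp only [Pi.smul_apply, smul_eq_mul, PiLp.smul_apply, RingHom.id_apply]
    ring

lemma differByShaping_iff {γ : ℝ} {R₁ R₂ : Reward S A} :
    DifferByShaping γ R₁ R₂ ↔ R₂ - R₁ ∈ LinearMap.range (shapingReward (A := A) γ) := by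
  constructor
  · rintro ⟨Φ, hΦ⟩
    refine ⟨Φ, ?_⟩
    ext ⟨s, a, s'⟩
    simp only [shapingReward, LinearMap.coe_mk, AddHom.coe_mk, PiLp.sub_apply, hΦ]
    ring
  · rintro ⟨Φ, hΦ⟩
    refine ⟨Φ, fun s a s' => ?_⟩
    have := congrArg (fun R : Reward S A => R (s, a, s')) hΦ
    simp only [shapingReward, LinearMap.coe_mk, AddHom.coe_mk, PiLp.sub_apply] at this
    linarith

variable [Fintype S]

/-- The rewards whose mean over successor states vanishes. -/
def nullRewards (τ : Transition S A) : Submodule ℝ (Reward S A) where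
  carrier := {R | ∀ s a, ∑ s', (τ s a s').toReal * R (s, a, s') = 0}
  add_mem' {R R'} h h' s a := by
    simp only [PiLp.add_apply, mul_add, Finset.sum_add_distrib, h s a, h' s a, add_zero]
  zero_mem' s a := by simp
  smul_mem' c R h s a := by
    simp only [PiLp.smul_apply, smul_eq_mul, mul_left_comm _ c, ← Finset.mul_sum, h s a, mul_zero]

lemma differByRedistribution_iff {τ : Transition S A} {R₁ R₂ : Reward S A} :
    DifferByRedistribution τ R₁ R₂ ↔ R₂ - R₁ ∈ nullRewards τ := by
  change _ ↔ ∀ s a, _ = _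
  simp only [DifferByRedistribution, PiLp.sub_apply, mul_sub, Finset.sum_sub_distrib, sub_eq_zero]
  exact forall₂_congr fun _ _ => eq_comm

/-- The directions of potential shaping and `S'`-redistribution. -/
def shapingDirections (τ : Transition S A) (γ : ℝ) : Submodule ℝ (Reward S A) :=
  LinearMap.range (shapingReward γ) ⊔ nullRewards τ

lemma mem_shapingClass_iff {τ : Transition S A} {γ : ℝ} {R R' : Reward S A} :
    R' ∈ shapingClass τ γ R ↔ R' - R ∈ shapingDirections τ γ := by
  simp only [shapingClass, Set.mem_ofPred_eq, differByShaping_iff, differByRedistribution_iff,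
    shapingDirections, Submodule.mem_sup]
  constructor
  · rintro ⟨R'', h1, h2⟩
    exact ⟨_, h1, _, h2, by abel⟩
  · rintro ⟨x, hx, y, hy, h⟩
    refine ⟨R + x, by simpa using hx, ?_⟩
    rwa [show R' - (R + x) = y by rw [← sub_sub, ← h]; abel]

variable [Fintype A]

/-- The shaping class is a coset of the shaping directions `W`. By Pythagoras its only element of
least norm is the projection to `Wᗮ`, so the choice operator must return it. -/
lemma starcCanon_eq (τ : Transition S A) (γ : ℝ) (R : Reward S A) :
    starcCanon τ γ R = (shapingDirections τ γ)ᗮ.starProjection R := by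
  set W := shapingDirections τ γ
  set p := Wᗮ.starProjection R
  have hmem : ∀ R', R' ∈ shapingClass τ γ R → ‖R'‖ ^ 2 = ‖p‖ ^ 2 + ‖R' - p‖ ^ 2 := by
    intro R' hR'
    rw [mem_shapingClass_iff] at hR'
    have hp : p ∈ Wᗮ := Submodule.starProjection_apply_mem _ _
    have hw : R' - p ∈ W := by
      have h1 : R - p ∈ W := by
        have := Submodule.sub_starProjection_mem_orthogonal (K := Wᗮ) R
        rwa [Submodule.orthogonal_orthogonal] at this
      have := W.add_mem hR' h1
      rwa [sub_add_sub_cancel] at this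
    have := norm_add_sq_real p (R' - p)
    rw [Submodule.inner_left_of_mem_orthogonal hw hp, add_sub_cancel] at this
    linarith
  have hpc : p ∈ shapingClass τ γ R := by
    rw [mem_shapingClass_iff]
    have := Submodule.sub_starProjection_mem_orthogonal (K := Wᗮ) R
    rw [Submodule.orthogonal_orthogonal] at this
    rw [← neg_sub]
    exact W.neg_mem this
  have hmin : ∀ R'' ∈ shapingClass τ γ R, ‖p‖ ≤ ‖R''‖ := fun R'' h => by
    have := hmem R'' h
    exact le_of_sq_le_sq (by nlinarith [sq_nonneg ‖R'' - p‖]) (norm_nonneg _)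
  obtain ⟨h1, h2⟩ := Classical.epsilon_spec (p := fun R' => R' ∈ shapingClass τ γ R ∧
    ∀ R'' ∈ shapingClass τ γ R, ‖R'‖ ≤ ‖R''‖) ⟨p, hpc, hmin⟩
  change starcCanon τ γ R ∈ _ at h1
  change ∀ R'' ∈ _, ‖starcCanon τ γ R‖ ≤ _ at h2
  have h3 := hmem _ h1
  have h4 := h2 p hpc
  have h5 : ‖starcCanon τ γ R - p‖ ^ 2 ≤ 0 := by
    nlinarith [norm_nonneg (starcCanon τ γ R)]
  have h6 : ‖starcCanon τ γ R - p‖ = 0 := by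
    nlinarith [norm_nonneg (starcCanon τ γ R - p), sq_nonneg ‖starcCanon τ γ R - p‖]
  exact sub_eq_zero.1 (norm_eq_zero.1 h6)

lemma starcCanon_add_of_mem {τ : Transition S A} {γ : ℝ} (R : Reward S A) {w : Reward S A}
    (hw : w ∈ shapingDirections τ γ) : starcCanon τ γ (R + w) = starcCanon τ γ R := by
  rw [starcCanon_eq, starcCanon_eq, map_add, Submodule.starProjection_orthogonal_apply_eq_zero hw,
    add_zero]

lemma starcCanon_eq_iff {τ : Transition S A} {γ : ℝ} {R R' : Reward S A} :
    starcCanon τ γ R = starcCanon τ γ R' ↔ R' - R ∈ shapingDirections τ γ := by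
  rw [starcCanon_eq, starcCanon_eq, ← sub_eq_zero, ← map_sub,
    Submodule.starProjection_apply_eq_zero_iff, Submodule.orthogonal_orthogonal,
    ← Submodule.neg_mem_iff, neg_sub]

lemma starcCanon_smul (τ : Transition S A) (γ c : ℝ) (R : Reward S A) :
    starcCanon τ γ (c • R) = c • starcCanon τ γ R := by
  rw [starcCanon_eq, starcCanon_eq, map_smul]

lemma starcCanon_add (τ : Transition S A) (γ : ℝ) (R R' : Reward S A) :
    starcCanon τ γ (R + R') = starcCanon τ γ R + starcCanon τ γ R' := by
  simp only [starcCanon_eq, map_add]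

lemma starcCanon_sub (τ : Transition S A) (γ : ℝ) (R R' : Reward S A) :
    starcCanon τ γ (R - R') = starcCanon τ γ R - starcCanon τ γ R' := by
  simp only [starcCanon_eq, map_sub]

lemma starcCanon_mem (τ : Transition S A) (γ : ℝ) (R : Reward S A) :
    starcCanon τ γ R ∈ (shapingDirections τ γ)ᗮ := by
  rw [starcCanon_eq]
  exact Submodule.starProjection_apply_mem _ _

lemma starcCanon_eq_self {τ : Transition S A} {γ : ℝ} {R : Reward S A}
    (h : R ∈ (shapingDirections τ γ)ᗮ) : starcCanon τ γ R = R := by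
  rw [starcCanon_eq, Submodule.starProjection_eq_self_iff.2 h]

lemma norm_starcCanon_le (τ : Transition S A) (γ : ℝ) (R : Reward S A) :
    ‖starcCanon τ γ R‖ ≤ ‖R‖ := by
  rw [starcCanon_eq]
  exact Submodule.norm_starProjection_apply_le _ _

lemma starcStandard_eq (τ : Transition S A) (γ : ℝ) (R : Reward S A) :
    starcStandard τ γ R = ‖starcCanon τ γ R‖⁻¹ • starcCanon τ γ R := by
  unfold starcStandard
  split_ifs with h
  · rfl
  · rw [norm_pos_iff, not_not] at h
    rw [h, smul_zero]

lemma starcStandard_congr {τ : Transition S A} {γ c : ℝ} (hc : 0 < c) {R R' : Reward S A}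
    (h : starcCanon τ γ R' = c • starcCanon τ γ R) :
    starcStandard τ γ R' = starcStandard τ γ R := by
  rw [starcStandard_eq, starcStandard_eq, h, norm_smul, smul_smul, Real.norm_eq_abs,
    abs_of_pos hc, mul_inv, mul_right_comm, inv_mul_cancel₀ hc.ne', one_mul]

lemma starcDist_comm (τ : Transition S A) (γ : ℝ) (R R' : Reward S A) :
    starcDist τ γ R R' = starcDist τ γ R' R := by
  rw [starcDist, starcDist, norm_sub_rev]

lemma starcDist_self (τ : Transition S A) (γ : ℝ) (R : Reward S A) : starcDist τ γ R R = 0 := by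
  simp [starcDist]

lemma starcStandard_eq_of_mem_shapingClass {τ : Transition S A} {γ : ℝ} {R R' : Reward S A}
    (h : R' ∈ shapingClass τ γ R) : starcStandard τ γ R = starcStandard τ γ R' := by
  rw [starcStandard_eq, starcStandard_eq,
    starcCanon_eq_iff.2 (mem_shapingClass_iff.1 h)]

lemma starcDist_congr_right {τ : Transition S A} {γ : ℝ} {R₁ R₂ : Reward S A}
    (h : R₂ ∈ shapingClass τ γ R₁) (R : Reward S A) :
    starcDist τ γ R R₁ = starcDist τ γ R R₂ := by
  unfold starcDist
  rw [starcStandard_eq_of_mem_shapingClass h]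

end Starc

/-! ### Balls, cones and angles -/

section Angles

open scoped RealInnerProductSpace

variable {E : Type*} [NormedAddCommGroup E] [InnerProductSpace ℝ E]

/-- Unit vectors at angle `θ` have squared distance `2 - 2 cos θ`, so the bound reads `cos θ ≥ 1 -
2ε²`. -/
lemma half_norm_normalized_sub_le_iff {x y : E} (hx : x ≠ 0) (hy : y ≠ 0) {ε : ℝ} (hε : 0 ≤ ε) :
    1 / 2 * ‖‖x‖⁻¹ • x - ‖y‖⁻¹ • y‖ ≤ ε ↔ ‖x‖ * ‖y‖ * (1 - 2 * ε ^ 2) ≤ ⟪x, y⟫ := by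
  have hx' := norm_pos_iff.2 hx
  have hy' := norm_pos_iff.2 hy
  have h1 : ‖‖x‖⁻¹ • x - ‖y‖⁻¹ • y‖ ^ 2 = 2 - 2 * (⟪x, y⟫ / (‖x‖ * ‖y‖)) := by
    rw [norm_sub_sq_real, norm_smul, norm_smul, norm_inv, norm_inv, norm_norm, norm_norm,
      inv_mul_cancel₀ hx'.ne', inv_mul_cancel₀ hy'.ne', real_inner_smul_left,
      real_inner_smul_right]
    field_simp
    ring
  rw [← le_div_iff₀' (mul_pos hx' hy')]
  constructor
  · intro h
    have : ‖‖x‖⁻¹ • x - ‖y‖⁻¹ • y‖ ^ 2 ≤ (2 * ε) ^ 2 :=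
      pow_le_pow_left₀ (norm_nonneg _) (by linarith) 2
    nlinarith
  · intro h
    have : ‖‖x‖⁻¹ • x - ‖y‖⁻¹ • y‖ ≤ 2 * ε :=
      le_of_sq_le_sq (by nlinarith) (by linarith)
    linarith

/-- With `s = sin θ` and `k = cos θ`: the ball lies in the cone. Expanding the square leaves `(‖y‖ -
‖x‖ * k)² ≥ 0`. -/
lemma ne_zero_and_inner_ge_of_norm_sub_le {x y : E} (hx : x ≠ 0) {k s : ℝ} (hk : 0 < k)
    (hks : s ^ 2 + k ^ 2 = 1) (h : ‖x - y‖ ≤ ‖x‖ * s) :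
    y ≠ 0 ∧ ‖x‖ * ‖y‖ * k ≤ ⟪x, y⟫ := by
  have hx' := norm_pos_iff.2 hx
  have h2 : ‖x - y‖ ^ 2 ≤ (‖x‖ * s) ^ 2 := pow_le_pow_left₀ (norm_nonneg _) h 2
  constructor
  · rintro rfl
    rw [sub_zero] at h2
    have : 0 < ‖x‖ ^ 2 * k ^ 2 := by positivity
    nlinarith
  · rw [norm_sub_sq_real] at h2
    nlinarith [sq_nonneg (‖y‖ - ‖x‖ * k)]

lemma exists_smul_norm_sub_le {x y : E} (hx : x ≠ 0) (hy : y ≠ 0) {k s : ℝ} (hk : 0 < k)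
    (hs : 0 ≤ s) (hks : s ^ 2 + k ^ 2 = 1) (h : ‖x‖ * ‖y‖ * k ≤ ⟪x, y⟫) :
    ∃ c : ℝ, 0 < c ∧ ‖c • x - y‖ ≤ ‖c • x‖ * s := by
  have hx' := norm_pos_iff.2 hx
  have hy' := norm_pos_iff.2 hy
  have hi : 0 < ⟪x, y⟫ := lt_of_lt_of_le (by positivity) h
  -- This scale makes `c • x - y` orthogonal to `y`, giving a right triangle with hypotenuse `c •
  -- x`.
  obtain ⟨c, hc⟩ : ∃ c, c = ‖y‖ ^ 2 / ⟪x, y⟫ := ⟨_, rfl⟩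
  have hc0 : 0 < c := hc ▸ by positivity
  have hci : c * ⟪x, y⟫ = ‖y‖ ^ 2 := by rw [hc, div_mul_cancel₀ _ hi.ne']
  refine ⟨c, hc0, le_of_sq_le_sq ?_ (by positivity)⟩
  have h1 : c * ‖x‖ * k ≤ ‖y‖ := by
    have := mul_le_mul_of_nonneg_left h hc0.le
    rw [hci] at this
    nlinarith
  have h2 : (c * ‖x‖ * k) ^ 2 ≤ ‖y‖ ^ 2 := pow_le_pow_left₀ (by positivity) h1 2
  rw [norm_sub_sq_real, real_inner_smul_left, hci, norm_smul, Real.norm_eq_abs, abs_of_pos hc0]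
  nlinarith

lemma sin_two_arcsin_sq_add_sq {ε : ℝ} (h0 : 0 ≤ ε) (h1 : ε ≤ 1) :
    0 ≤ Real.sin (2 * Real.arcsin ε) ∧
      Real.sin (2 * Real.arcsin ε) ^ 2 + (1 - 2 * ε ^ 2) ^ 2 = 1 := by
  rw [Real.sin_two_mul, Real.sin_arcsin (by linarith) h1, Real.cos_arcsin]
  have := Real.sq_sqrt (show 0 ≤ 1 - ε ^ 2 by nlinarith)
  exact ⟨by positivity, by rw [mul_pow, this]; ring⟩

end Angles

/-- Injectivity of `p` makes the prescription consistent on its range; elsewhere the identity is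
allowed by reflexivity. -/
lemma exists_extension_of_rel {X : Type*} {r : X → X → Prop} (hr : ∀ x, r x x) {p q : X → X}
    (hp : Function.Injective p) (h : ∀ x, r (p x) (q x)) :
    ∃ f : X → X, (∀ x, r x (f x)) ∧ ∀ x, f (p x) = q x := by
  refine ⟨Function.extend p q id, fun x => ?_, fun x => hp.extend_apply q id x⟩
  by_cases hx : ∃ y, p y = x
  · obtain ⟨y, rfl⟩ := hx
    rw [hp.extend_apply]
    exact h y
  · rw [Function.extend_apply' _ _ _ hx]
    exact hr x

/-! ### Decomposing the close transformations -/

section Decomposition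

open scoped RealInnerProductSpace

variable {S A : Type*} [Fintype S] [Fintype A]

/-- If exactly one canonical reward vanishes, the distance is `1/2`; this is the case that `ε < 1/2`
rules out. -/
lemma starcDist_le_iff {τ : Transition S A} {γ ε : ℝ} (h0 : 0 ≤ ε) (h1 : ε < 1 / 2)
    {R R' : Reward S A} :
    starcDist τ γ R R' ≤ ε ↔ (starcCanon τ γ R = 0 ∧ starcCanon τ γ R' = 0) ∨
      (starcCanon τ γ R ≠ 0 ∧ starcCanon τ γ R' ≠ 0 ∧
        ‖starcCanon τ γ R‖ * ‖starcCanon τ γ R'‖ * (1 - 2 * ε ^ 2) ≤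
          ⟪starcCanon τ γ R, starcCanon τ γ R'⟫) := by
  rw [starcDist, starcStandard_eq, starcStandard_eq]
  by_cases hx : starcCanon τ γ R = 0 <;> by_cases hy : starcCanon τ γ R' = 0
  · simp [hx, hy, h0]
  · simpa [hx, hy, norm_smul] using h1
  · simpa [hx, hy, norm_smul] using h1
  · rw [half_norm_normalized_sub_le_iff hx hy h0]
    simp [hx, hy]

lemma IsElementary.starcStandard_eq {τ : Transition S A} {γ : ℝ} {f : Reward S A → Reward S A}
    (hf : IsElementary τ γ f) (R : Reward S A) :
    starcStandard τ γ (f R) = starcStandard τ γ R := by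
  rcases hf R with h | h | ⟨c, hc, h⟩
  · rw [differByShaping_iff] at h
    exact (starcStandard_eq_of_mem_shapingClass (mem_shapingClass_iff.2
      (Submodule.mem_sup_left h))).symm
  · rw [differByRedistribution_iff] at h
    exact (starcStandard_eq_of_mem_shapingClass (mem_shapingClass_iff.2
      (Submodule.mem_sup_right h))).symm
  · exact starcStandard_congr hc (by rw [h, starcCanon_smul])

lemma starcStandard_composeList {τ : Transition S A} {γ : ℝ}
    {l : List (Reward S A → Reward S A)} (hl : ∀ f ∈ l, IsElementary τ γ f) (R : Reward S A) :
    starcStandard τ γ (composeList l R) = starcStandard τ γ R := by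
  induction l with
  | nil => rfl
  | cons f l ih =>
    exact ((hl f List.mem_cons_self).starcStandard_eq _).trans
      (ih fun g hg => hl g (List.mem_cons_of_mem f hg))

/-- Elementary maps preserve the standardised reward, and projection does not increase norms, so the
ball bound on `u` passes to canonical rewards. -/
lemma decomposableTransformations_subset (τ : Transition S A) (γ : ℝ) {ε : ℝ} (h0 : 0 ≤ ε)
    (h1 : ε < 1 / 2) : decomposableTransformations τ γ ε ⊆ closeTransformations τ γ ε := by
  rintro _ ⟨l₁, l₂, u, rfl, hu, hl₁, hl₂⟩ R
  have hR : starcDist τ γ R ((composeList l₁ ∘ u ∘ composeList l₂) R) =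
      starcDist τ γ (composeList l₂ R) (u (composeList l₂ R)) := by
    rw [starcDist, starcDist, ← starcStandard_composeList hl₂ R]
    exact congrArg (fun v => 1 / 2 * ‖_ - v‖) (starcStandard_composeList hl₁ _)
  rw [hR]
  generalize composeList l₂ R = R
  obtain ⟨-, hks⟩ := sin_two_arcsin_sq_add_sq h0 (by linarith)
  rw [starcDist_le_iff h0 h1]
  have h2 : ‖starcCanon τ γ R - starcCanon τ γ (u R)‖ ≤
      ‖starcCanon τ γ R‖ * Real.sin (2 * Real.arcsin ε) := by
    rw [← starcCanon_sub]
    exact (norm_starcCanon_le τ γ _).trans (hu R)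
  by_cases hx : starcCanon τ γ R = 0
  · left
    rw [hx] at h2
    refine ⟨hx, ?_⟩
    simpa using h2
  · exact Or.inr ⟨hx, ne_zero_and_inner_ge_of_norm_sub_le hx (by nlinarith) hks h2⟩

/-- A linear functional that sees constant rewards, but neither `S'`-redistribution nor the
orthogonal complement of the shaping directions. -/
lemma exists_functional [Nonempty S] [Nonempty A] (τ : Transition S A) {γ : ℝ} (hγ : γ ≠ 1) :
    ∃ (e : Reward S A) (l : Reward S A →ₗ[ℝ] ℝ), e ∈ LinearMap.range (shapingReward (A := A) γ) ∧
      l e = 1 ∧ (∀ R ∈ nullRewards τ, l R = 0) ∧ ∀ R ∈ (shapingDirections τ γ)ᗮ, l R = 0 := by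
  let e : Reward S A := shapingReward γ fun _ => 1
  have he : e ∈ LinearMap.range (shapingReward (A := A) γ) := ⟨_, rfl⟩
  -- Being a shaping direction orthogonal to `nullRewards τ`, `h` pairs to zero with both required
  -- subspaces. It is nonzero because `e` is the constant `γ - 1`, which has nonzero mean.
  let h : Reward S A := (nullRewards τ)ᗮ.starProjection e
  have hN : e - h ∈ nullRewards τ := by
    have := Submodule.sub_starProjection_mem_orthogonal (K := (nullRewards τ)ᗮ) e
    rwa [Submodule.orthogonal_orthogonal] at this
  have hO : h ∈ (nullRewards τ)ᗮ := Submodule.starProjection_apply_mem _ _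
  have hW : h ∈ shapingDirections τ γ := by
    have := (shapingDirections τ γ).sub_mem (Submodule.mem_sup_left he) (Submodule.mem_sup_right hN)
    rwa [sub_sub_cancel] at this
  have h0 : h ≠ 0 := by
    intro h0
    rw [h0, sub_zero] at hN
    have := hN (Classical.arbitrary S) (Classical.arbitrary A)
    simp only [e, shapingReward, LinearMap.coe_mk, AddHom.coe_mk, PMF.sum_toReal_mul_const] at this
    exact hγ (by linarith)
  have hhe : ⟪h, e⟫ = ‖h‖ ^ 2 := by
    rw [← real_inner_self_eq_norm_sq, ← sub_eq_zero, ← inner_sub_right]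
    exact Submodule.inner_left_of_mem_orthogonal hN hO
  refine ⟨e, (‖h‖ ^ 2)⁻¹ • (innerₛₗ ℝ h), he, ?_, fun R hR => ?_, fun R hR => ?_⟩
  · rw [LinearMap.smul_apply, innerₛₗ_apply_apply, hhe, smul_eq_mul,
      inv_mul_cancel₀ (pow_ne_zero 2 (norm_ne_zero_iff.2 h0))]
  · rw [LinearMap.smul_apply, innerₛₗ_apply_apply,
      Submodule.inner_left_of_mem_orthogonal hR hO, smul_zero]
  · rw [LinearMap.smul_apply, innerₛₗ_apply_apply,
      Submodule.inner_right_of_mem_orthogonal hW hR, smul_zero]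

lemma closeTransformations_subset [Nonempty S] [Nonempty A] (τ : Transition S A) {γ : ℝ}
    (hγ : γ ≠ 1) {ε : ℝ} (h0 : 0 ≤ ε) (h1 : ε < 1 / 2) :
    closeTransformations τ γ ε ⊆ decomposableTransformations τ γ ε := by
  classical
  intro t ht
  obtain ⟨hs, hks⟩ := sin_two_arcsin_sq_add_sq h0 (by linarith)
  have hk : 0 < 1 - 2 * ε ^ 2 := by nlinarith
  obtain ⟨s, hsdef⟩ : ∃ s, s = Real.sin (2 * Real.arcsin ε) := ⟨_, rfl⟩
  rw [← hsdef] at hs hks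
  let c : Reward S A → Reward S A := starcCanon τ γ
  -- Taking `k = 1` when `c R = 0` keeps `size` below compatible with the rescaling.
  have hscale : ∀ R, ∃ k : ℝ, 0 < k ∧ (c R = 0 → k = 1) ∧
      ‖k • c R - c (t R)‖ ≤ ‖k • c R‖ * s := by
    intro R
    rcases (starcDist_le_iff h0 h1).1 (ht R) with ⟨hx, hy⟩ | ⟨hx, hy, h⟩
    · exact ⟨1, one_pos, fun _ => rfl, by simp [c, hx, hy]⟩
    · obtain ⟨k, hk0, hk⟩ := exists_smul_norm_sub_le hx hy hk hs hks h
      exact ⟨k, hk0, fun h => absurd h hx, hk⟩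
  choose k hk0 hk1 hks' using hscale
  obtain ⟨e, l, he, hle, hlN, hlO⟩ := exists_functional (A := A) τ hγ
  have heW : ∀ a : ℝ, a • e ∈ shapingDirections τ γ := fun a =>
    Submodule.smul_mem _ a (Submodule.mem_sup_left he)
  obtain ⟨code, hcode⟩ : ∃ code : Reward S A → ℝ, Function.Injective code :=
    ⟨embeddingReal (Reward S A), (measurableEmbedding_embeddingReal _).injective⟩
  -- A weight that scales along with the code under `k R`, so the code can be read off after scaling
  -- by an unknown factor.
  let size : Reward S A → ℝ := fun x => if x = 0 then 1 else ‖x‖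
  have hsize : ∀ x, size x ≠ 0 := fun x => by
    simp only [size]
    split_ifs with hx
    · exact one_ne_zero
    · exact norm_ne_zero_iff.2 hx
  have hdecode : ∀ p : Reward S A → Reward S A, (∀ R, l (p R) = size (c (p R)) * code R) →
      Function.Injective p := fun p hp R R' h => hcode <| by
    have h2 := hp R
    rw [h, hp R'] at h2
    exact (mul_left_cancel₀ (hsize _) h2).symm
  have hdecode' : ∀ p : Reward S A → Reward S A, (∀ R, l (p R) = code R) →
      Function.Injective p := fun p hp R R' h => hcode <| by
    rw [← hp R, h, hp R']
  -- The reward is encoded along `e`, which keeps every intermediate map injective.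
  let p₁ : Reward S A → Reward S A := fun R => R + (size (c R) * code R - l R) • e
  let p₂ : Reward S A → Reward S A := fun R => k R • p₁ R
  -- Scaling is over, so the bare code replaces the weighted one; the perturbation in `p₄` moves
  -- within `Wᗮ`, invisible to `l`.
  let p₃ : Reward S A → Reward S A := fun R => p₂ R + (code R - l (p₂ R)) • e
  let p₄ : Reward S A → Reward S A := fun R => p₃ R + (c (t R) - k R • c R)
  have hc₁ : ∀ R, c (p₁ R) = c R := fun R => starcCanon_add_of_mem R (heW _)
  have hc₂ : ∀ R, c (p₂ R) = k R • c R := fun R =>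
    (starcCanon_smul τ γ _ _).trans (by rw [← hc₁])
  have hc₃ : ∀ R, c (p₃ R) = k R • c R := fun R =>
    (starcCanon_add_of_mem _ (heW _)).trans (hc₂ R)
  have hmemO : ∀ R, c (t R) - k R • c R ∈ (shapingDirections τ γ)ᗮ := fun R =>
    Submodule.sub_mem _ (starcCanon_mem τ γ _) (Submodule.smul_mem _ _ (starcCanon_mem τ γ _))
  have hc₄ : ∀ R, c (p₄ R) = c (t R) := fun R => by
    have h2 : c (p₄ R) = c (p₃ R) + c (c (t R) - k R • c R) := starcCanon_add τ γ _ _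
    have h3 : c (c (t R) - k R • c R) = c (t R) - k R • c R := starcCanon_eq_self (hmemO R)
    rw [h2, h3, hc₃, add_sub_cancel]
  have hrest : ∀ R, ∃ x ∈ LinearMap.range (shapingReward (A := A) γ), ∃ y ∈ nullRewards τ,
      x + y = t R - p₄ R := fun R =>
    Submodule.mem_sup.1 (starcCanon_eq_iff.1 (hc₄ R))
  choose x hx y hy hxy using hrest
  -- Redistribution precedes the final shaping because `l` does not see it. The last shaping may
  -- destroy the code, as it should: `t` need not be injective.
  let p₅ : Reward S A → Reward S A := fun R => p₄ R + y R
  have hl₁ : ∀ R, l (p₁ R) = size (c R) * code R := fun R => by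
    simp only [p₁, map_add, map_smul, hle, smul_eq_mul]
    ring
  have hl₃ : ∀ R, l (p₃ R) = code R := fun R => by
    simp only [p₃, map_add, map_smul, hle, smul_eq_mul]
    ring
  have hl₄ : ∀ R, l (p₄ R) = code R := fun R => by
    simp only [p₄]
    rw [map_add, hlO _ (hmemO R), add_zero, hl₃]
  have hl₅ : ∀ R, l (p₅ R) = code R := fun R => by
    simp only [p₅]
    rw [map_add, hlN _ (hy R), add_zero, hl₄]
  have hinj₁ : Function.Injective p₁ := hdecode _ fun R => by rw [hc₁, hl₁]
  have hinj₂ : Function.Injective p₂ := hdecode _ fun R => by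
    have : size (k R • c R) = k R * size (c R) := by
      by_cases hcR : c R = 0
      · simp [size, hcR, hk1 R hcR]
      · simp [size, hcR, (hk0 R).ne', norm_smul, abs_of_pos (hk0 R)]
    rw [hc₂, this]
    simp only [p₂]
    rw [map_smul, hl₁, smul_eq_mul, mul_assoc]
  have hshape : ∀ R : Reward S A, DifferByShaping γ R R := fun R =>
    differByShaping_iff.2 (by rw [sub_self]; exact Submodule.zero_mem _)
  obtain ⟨f₁, hf₁, hp₁⟩ := exists_extension_of_rel hshape (q := p₁) Function.injective_id
    fun R => differByShaping_iff.2 (by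
      simp only [p₁, id, add_sub_cancel_left]
      exact Submodule.smul_mem _ _ he)
  obtain ⟨f₂, hf₂, hp₂⟩ := exists_extension_of_rel (r := DifferByScaling)
    (fun R => ⟨1, one_pos, (one_smul ℝ R).symm⟩) (q := p₂) hinj₁ fun R => ⟨k R, hk0 R, rfl⟩
  obtain ⟨f₃, hf₃, hp₃⟩ := exists_extension_of_rel hshape (q := p₃) hinj₂
    fun R => differByShaping_iff.2 (by
      simp only [p₃, add_sub_cancel_left]
      exact Submodule.smul_mem _ _ he)
  obtain ⟨u, hu, hp₄⟩ := exists_extension_of_rel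
    (r := fun R R' : Reward S A => ‖R - R'‖ ≤ ‖c R‖ * s)
    (fun R => by rw [sub_self, norm_zero]; positivity) (q := p₄) (hdecode' p₃ hl₃)
    (fun R => by
      have h2 : p₃ R - p₄ R = k R • c R - c (t R) := by
        simp only [p₄]
        abel
      rw [h2, hc₃]
      exact hks' R)
  obtain ⟨f₅, hf₅, hp₅⟩ := exists_extension_of_rel (r := DifferByRedistribution τ)
    (fun R _ _ => rfl) (q := p₅) (hdecode' p₄ hl₄)
    fun R => differByRedistribution_iff.2 (by
      simp only [p₅, add_sub_cancel_left]
      exact hy R)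
  obtain ⟨f₆, hf₆, hp₆⟩ := exists_extension_of_rel hshape (q := t) (hdecode' p₅ hl₅)
    fun R => differByShaping_iff.2 (by
      have h2 : t R - p₅ R = x R := by
        simp only [p₅]
        rw [← sub_sub, ← hxy, add_sub_cancel_right]
      rw [h2]
      exact hx R)
  refine ⟨[f₆, f₅], [f₃, f₂, f₁], u, ?_, ?_, ?_, ?_⟩
  · funext R
    have hp₁' : f₁ R = p₁ R := hp₁ R
    simp only [composeList, List.foldr_cons, List.foldr_nil, Function.comp_apply, id, hp₁', hp₂,
      hp₃, hp₄, hp₅, hp₆]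
  · rw [← hsdef]
    exact hu
  · simp only [List.mem_cons, List.not_mem_nil, or_false]
    rintro f (rfl | rfl) R
    · exact Or.inl (hf₆ R)
    · exact Or.inr (Or.inl (hf₅ R))
  · simp only [List.mem_cons, List.not_mem_nil, or_false]
    rintro f (rfl | rfl | rfl) R
    · exact Or.inl (hf₃ R)
    · exact Or.inr (Or.inr (hf₂ R))
    · exact Or.inl (hf₁ R)

end Decomposition

end

theorem corollary1 {S A : Type*} [Fintype S] [Nonempty S] [Fintype A] [Nonempty A]
    (τ : Transition S A) (μ₀ : PMF S) (hreach : AllReachable τ μ₀)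
    (γ : ℝ) (hγ0 : 0 < γ) (hγ1 : γ < 1) (β : ℝ) (hβ : 0 < β) (α : ℝ) (hα : 0 < α)
    (ε : ℝ) (hε : 0 ≤ ε) (Rhat : Set (Reward S A)) (g : Rhat → Policy S A) :
    (IsRobust Rhat (starcDist τ γ) ε (fun R : Rhat => boltzmannRational τ γ β R) g ↔
      ∃ t ∈ closeTransformations τ γ ε ∩ preserving Rhat,
        (g = fun R : Rhat => boltzmannRational τ γ β (t R)) ∧
        (fun R : Rhat => boltzmannRational τ γ β R) ≠ g) ∧
    (IsRobust Rhat (starcDist τ γ) ε (fun R : Rhat => maxCausalEntropy τ μ₀ γ α R) g ↔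
      ∃ t ∈ closeTransformations τ γ ε ∩ preserving Rhat,
        (g = fun R : Rhat => maxCausalEntropy τ μ₀ γ α (t R)) ∧
        (fun R : Rhat => maxCausalEntropy τ μ₀ γ α R) ≠ g) ∧
    (ε < 1 / 2 → closeTransformations τ γ ε = decomposableTransformations τ γ ε) := by
  refine ⟨isRobust_iff_of_congr hε (starcDist_self τ γ) (starcDist_comm τ γ)
      (fun R₁ R₂ h => starcDist_congr_right
        (mem_shapingClass_of_boltzmannRational_eq τ hγ0 hγ1 hβ h)) Rhat g,
    isRobust_iff_of_congr hε (starcDist_self τ γ) (starcDist_comm τ γ)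
      (fun R₁ R₂ h => starcDist_congr_right
        (mem_shapingClass_of_maxCausalEntropy_eq τ hreach hγ0 hγ1 hα h)) Rhat g,
    fun h1 => (closeTransformations_subset τ hγ1.ne hε h1).antisymm
      (decomposableTransformations_subset τ γ hε h1)⟩
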